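/- For a finite graph $G$ and a real number $t\ge 0$, the $t$-improper chromatic number $\chi^t(G)$ is the least number of colours in a colouring of the vertices of $G$ in which each colour class induces a subgraph of maximum degree at most $t$. Let $G_{n,p}$ be the random graph on $\{1,\dots,n\}$ in which each of the $\binom n2$ possible edges is present independently with probability $p$. An event holds asymptotically almost surely (a.a.s.) if its probability tends to $1$ as $n\to\infty$; and for a graph parameter $X$, ``a.a.s. $X(G_{n,p})\sim f(n)$'' means that for every $\varepsilon>0$, a.a.s. $(1-\varepsilon)f(n)\le X(G_{n,p})\le(1+\varepsilon)f(n)$. Theorem. Fix $0<p<1$ and let $b=1/(1-p)$. There exists a function $\kappa_p:[0,\infty)\to\mathbb R$, depending only on $p$, that is continuous and strictly increasing, with $\kappa_p(0)=2/\ln b$ and $\kappa_p(\tau)\sim\tau/p$ as $\tau\to\infty$, such that the following holds for every sequence $t=t(n)\ge 0$. If $t(n)=o(n)$, then a.a.s. \[ \chi^{t}(G_{n,p})\sim\frac{n}{\kappa_p(t/\ln n)\,\ln n}. \] Furthermore, if $t(n)\sim np/x$, where $x>0$ is fixed and not an integer, then $\chi^{t}(G_{n,p})=\lceil x\rceil$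 a.a.s. -/

import Mathlib

open Filter Topology Asymptotics

namespace SimpleGraph

variable {V : Type*}

/-- A vertex set `S` is `t`-dependent in `G` if every vertex of `S` has at most `t` neighbours
in `S`, that is, if the subgraph induced by `S` has maximum degree at most `t`. -/
def IsDependentSet (G : SimpleGraph V) (t : ℝ) (S : Set V) : Prop :=
  ∀ v ∈ S, ({w | w ∈ S ∧ G.Adj v w}.ncard : ℝ) ≤ t

/-- A colouring is `t`-improper if all its colour classes are `t`-dependent sets. -/
def IsImproperColoring (G : SimpleGraph V) (t : ℝ) {C : Type*} (c : V → C) : Prop :=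
  ∀ i : C, G.IsDependentSet t {v | c v = i}

/-- The `t`-improper chromatic number of a finite graph (for `t ≥ 0`): the least number of colours
in a `t`-improper colouring. -/
noncomputable def improperChromaticNumber [Finite V] (G : SimpleGraph V) (t : ℝ) : ℕ :=
  sInf {k : ℕ | ∃ c : V → Fin k, G.IsImproperColoring t c}

end SimpleGraph

/-- A property of graphs holds asymptotically almost surely in the binomial random graph `G(n, p)`
on `n` labelled vertices: its probability tends to `1` as `n → ∞`. -/
def HoldsAAS (p : unitInterval) (P : ∀ n : ℕ, SimpleGraph (Fin n) → Prop) : Prop :=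
  Tendsto (fun n : ℕ => (SimpleGraph.binomialRandom (Fin n) p).real {G | P n G}) atTop (𝓝 1)

/-- `X(G(n, p)) ∼ f(n)` asymptotically almost surely: for every `ε > 0`, a.a.s.
`(1 - ε) f(n) ≤ X(G(n, p)) ≤ (1 + ε) f(n)`. -/
def EquivalentAAS (p : unitInterval) (X : ∀ n : ℕ, SimpleGraph (Fin n) → ℝ) (f : ℕ → ℝ) : Prop :=
  ∀ ε : ℝ, 0 < ε → HoldsAAS p fun n G => (1 - ε) * f n ≤ X n G ∧ X n G ≤ (1 + ε) * f n

/-! Write L for `negLogLaplace p`. A t-dependent set of k vertices spans at most kt/2 edges, and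
exponential moments bound the probability of dependence by exp(-(k/2)((k-1)L(l) - lt)) for every l ≥
0. Lowering the edge density inside the set by an exponential tilt shows that, for a suitable l,
this is sharp up to a factor exp(-ηk²). The expected number of dependent k-sets is therefore about
exp((k/2)(2 ln n - sup_l (kL(l) - lt))), and the threshold is the largest k with kL(l) ≤ 2 ln n + lt
for all l, that is k = κ(t/ln n) ln n. This is why `kappa` is an infimum of functions affine in τ,
and its analytic properties come from that form: l → ∞ governs κ(0), and small l governs the growth
τ/p.

Lower bound on the number of colours: by the first moment no dependent set has more than (1+ε)κ ln n
vertices, so no colour class does (`eventually_bernoulliProb_lower_le`).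

Upper bound, t ≤ T ln n: by Janson's inequality a given set of n^(1-ε/4) vertices lacks a dependent
set of nearly κ ln n vertices with probability at most exp(-2n), which survives a union bound over
all such sets; dependent sets are then removed greedily (`eventually_forall_bernoulliExp_prod_le`,
`exists_greedy_coloring`). The correlations needed for Janson are bounded in two ways: for a small
overlap by deleting its edges, for a large one by exponential moments of the edges outside it.

Upper bound, t ≥ T ln n: here κ is close to t/(p ln n), and arbitrary blocks of slightly fewer than
t/p vertices are already dependent by Chernoff's bound. The linear regime t ∼ np/x uses blocks for
the upper bound and the first moment, with l near 0, for the lower bound.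

All estimates are finite sums on the cube of edge indicators; `binomialRandom_real_eq` carries them
to the random graph. -/

/-! ### The Bernoulli measure on a finite cube -/

section Cube

variable {E : Type*} [Fintype E]

/-- The mass of a point of the cube under independent Bernoulli coordinates. -/
def bernoulliWeight (p : E → ℝ) (ω : E → Bool) : ℝ :=
  ∏ e, if ω e then p e else 1 - p e

theorem bernoulliWeight_nonneg {p : E → ℝ} (h0 : ∀ e, 0 ≤ p e) (h1 : ∀ e, p e ≤ 1)
    (ω : E → Bool) : 0 ≤ bernoulliWeight p ω := by
  refine Finset.prod_nonneg fun e _ => ?_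
  split_ifs
  · exact h0 e
  · linarith [h1 e]

variable [DecidableEq E]

/-- The expectation of a function on the cube under independent Bernoulli coordinates. -/
def bernoulliExp (p : E → ℝ) (f : (E → Bool) → ℝ) : ℝ :=
  ∑ ω, bernoulliWeight p ω * f ω

theorem bernoulliExp_mono {p : E → ℝ} (h0 : ∀ e, 0 ≤ p e) (h1 : ∀ e, p e ≤ 1)
    {f g : (E → Bool) → ℝ} (h : ∀ ω, f ω ≤ g ω) : bernoulliExp p f ≤ bernoulliExp p g :=
  Finset.sum_le_sum fun ω _ =>
    mul_le_mul_of_nonneg_left (h ω) (bernoulliWeight_nonneg h0 h1 ω)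

theorem bernoulliExp_nonneg {p : E → ℝ} (h0 : ∀ e, 0 ≤ p e) (h1 : ∀ e, p e ≤ 1)
    {f : (E → Bool) → ℝ} (h : ∀ ω, 0 ≤ f ω) : 0 ≤ bernoulliExp p f :=
  Finset.sum_nonneg fun ω _ => mul_nonneg (bernoulliWeight_nonneg h0 h1 ω) (h ω)

theorem bernoulliExp_const_mul (p : E → ℝ) (c : ℝ) (f : (E → Bool) → ℝ) :
    bernoulliExp p (fun ω => c * f ω) = c * bernoulliExp p f := by
  simp only [bernoulliExp, Finset.mul_sum]
  exact Finset.sum_congr rfl fun ω _ => by ring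

theorem bernoulliExp_add (p : E → ℝ) (f g : (E → Bool) → ℝ) :
    bernoulliExp p (fun ω => f ω + g ω) = bernoulliExp p f + bernoulliExp p g := by
  simp only [bernoulliExp, mul_add, Finset.sum_add_distrib]

theorem bernoulliExp_sub (p : E → ℝ) (f g : (E → Bool) → ℝ) :
    bernoulliExp p (fun ω => f ω - g ω) = bernoulliExp p f - bernoulliExp p g := by
  simp only [bernoulliExp, mul_sub, Finset.sum_sub_distrib]

theorem bernoulliExp_sum (p : E → ℝ) {ι : Type*} (s : Finset ι) (f : ι → (E → Bool) → ℝ) :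
    bernoulliExp p (fun ω => ∑ i ∈ s, f i ω) = ∑ i ∈ s, bernoulliExp p (f i) := by
  simp only [bernoulliExp, Finset.mul_sum]
  exact Finset.sum_comm

/-- The expectation of a product of functions of single coordinates. -/
theorem bernoulliExp_prod (p : E → ℝ) (φ : E → Bool → ℝ) :
    bernoulliExp p (fun ω => ∏ e, φ e (ω e)) =
      ∏ e, (p e * φ e true + (1 - p e) * φ e false) := by
  have h : ∀ e, p e * φ e true + (1 - p e) * φ e false =
      ∑ b : Bool, (if b then p e else 1 - p e) * φ e b := fun e => by simp
  simp only [h, Fintype.prod_sum, bernoulliExp, bernoulliWeight, Finset.prod_mul_distrib]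

theorem bernoulliExp_const (p : E → ℝ) (c : ℝ) : bernoulliExp p (fun _ => c) = c := by
  have h := bernoulliExp_prod p (fun _ _ => 1)
  simp only [Finset.prod_const_one, mul_one, add_sub_cancel] at h
  simpa [h] using bernoulliExp_const_mul p c (fun _ => 1)

/-- Fubini for the splitting of the coordinates into those in `F` and the others; the source of
independence below. -/
theorem bernoulliExp_eq_sum_sum (p : E → ℝ) (F : Set E) [DecidablePred (· ∈ F)]
    (f : (E → Bool) → ℝ) :
    bernoulliExp p f = ∑ a : {e // e ∈ F} → Bool, ∑ b : {e // ¬ e ∈ F} → Bool,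
      (bernoulliWeight (fun e => p e.1) a * bernoulliWeight (fun e => p e.1) b) *
        f ((Equiv.piEquivPiSubtypeProd (· ∈ F) fun _ => Bool).symm (a, b)) := by
  rw [← Fintype.sum_prod_type', bernoulliExp,
    ← (Equiv.piEquivPiSubtypeProd (· ∈ F) fun _ => Bool).symm.sum_comp]
  refine Finset.sum_congr rfl fun x _ => ?_
  congr 1
  rw [bernoulliWeight, ← Fintype.prod_subtype_mul_prod_subtype (· ∈ F)]
  congr 1
  · exact Finset.prod_congr rfl fun e _ => by simp [Equiv.piEquivPiSubtypeProd, e.2]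
  · exact Finset.prod_congr rfl fun e _ => by simp [Equiv.piEquivPiSubtypeProd, e.2]

/-- Functions of disjoint sets of coordinates are independent. -/
theorem bernoulliExp_mul_of_dependsOn (p : E → ℝ) {f g : (E → Bool) → ℝ} {A B : Set E}
    (hf : DependsOn f A) (hg : DependsOn g B) (hAB : Disjoint A B) :
    bernoulliExp p (fun ω => f ω * g ω) = bernoulliExp p f * bernoulliExp p g := by
  classical
  let Φ := (Equiv.piEquivPiSubtypeProd (· ∈ A) fun _ : E => Bool).symm
  have h1 : ∀ a b, f (Φ (a, b)) = f (Φ (a, fun _ => false)) := fun a b =>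
    hf fun e he => by simp [Φ, Equiv.piEquivPiSubtypeProd, he]
  have h2 : ∀ a b, g (Φ (a, b)) = g (Φ (fun _ => false, b)) := fun a b =>
    hg fun e he => by
      have : e ∉ A := fun h => Set.disjoint_left.1 hAB h he
      simp [Φ, Equiv.piEquivPiSubtypeProd, this]
  have hone : ∀ {E' : Type _} [Fintype E'] [DecidableEq E'] (q : E' → ℝ),
      ∑ a, bernoulliWeight q a = 1 := fun q => by
    simpa [bernoulliExp] using bernoulliExp_const q 1
  have e1 : bernoulliExp p f =
      ∑ a, bernoulliWeight (fun e : {e // e ∈ A} => p e.1) a * f (Φ (a, fun _ => false)) := by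
    rw [bernoulliExp_eq_sum_sum p A]
    refine Finset.sum_congr rfl fun a _ => ?_
    rw [Finset.sum_congr rfl fun b _ => by rw [h1 a b, mul_right_comm], ← Finset.mul_sum, hone,
      mul_one]
  have e2 : bernoulliExp p g =
      ∑ b, bernoulliWeight (fun e : {e // ¬ e ∈ A} => p e.1) b * g (Φ (fun _ => false, b)) := by
    rw [bernoulliExp_eq_sum_sum p A, Finset.sum_comm]
    refine Finset.sum_congr rfl fun b _ => ?_
    rw [Finset.sum_congr rfl fun a _ => by rw [h2 a b, mul_assoc], ← Finset.sum_mul, hone,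
      one_mul]
  rw [bernoulliExp_eq_sum_sum p A, e1, e2, Finset.sum_mul_sum]
  refine Finset.sum_congr rfl fun a _ => Finset.sum_congr rfl fun b _ => ?_
  rw [h1 a b, h2 a b]
  ring

/-- **Harris's inequality** for a decreasing and an increasing function. -/
theorem bernoulliExp_mul_le_of_antitone_of_monotone {p : E → ℝ} (h0 : ∀ e, 0 ≤ p e)
    (h1 : ∀ e, p e ≤ 1) {f g : (E → Bool) → ℝ} (hf : Antitone f) (hg : Monotone g)
    (hg0 : ∀ ω, 0 ≤ g ω) :
    bernoulliExp p (fun ω => f ω * g ω) ≤ bernoulliExp p f * bernoulliExp p g := by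
  -- FKG asks for two nonnegative increasing functions, so the decreasing `f` is replaced by `f ⊥ -
  -- f`. A product weight satisfies the lattice condition with equality.
  have key := fkg (fun ω => f ⊥ - f ω) g (bernoulliWeight p) (bernoulliWeight_nonneg h0 h1)
    (fun ω => sub_nonneg.2 (hf bot_le)) hg0 (fun a b hab => sub_le_sub_left (hf hab) _) hg
    (fun a b => by
      simp only [bernoulliWeight, ← Finset.prod_mul_distrib]
      refine le_of_eq (Finset.prod_congr rfl fun e _ => ?_)
      rcases le_total (a e) (b e) with h | h
      · rw [Pi.inf_apply, Pi.sup_apply, inf_eq_left.2 h, sup_eq_right.2 h]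
      · rw [Pi.inf_apply, Pi.sup_apply, inf_eq_right.2 h, sup_eq_left.2 h, mul_comm])
  have e1 : ∑ a, bernoulliWeight p a = 1 := by simpa [bernoulliExp] using bernoulliExp_const p 1
  have e2 : ∑ a, bernoulliWeight p a * (f ⊥ - f a) = f ⊥ - bernoulliExp p f := by
    have := bernoulliExp_sub p (fun _ => f ⊥) f
    rwa [bernoulliExp_const] at this
  have e3 : ∑ a, bernoulliWeight p a * ((f ⊥ - f a) * g a) =
      f ⊥ * bernoulliExp p g - bernoulliExp p (fun ω => f ω * g ω) := by
    rw [← bernoulliExp_const_mul, ← bernoulliExp_sub]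
    exact Finset.sum_congr rfl fun ω _ => by ring
  rw [e1, e2, e3] at key
  change _ * bernoulliExp p g ≤ _ at key
  linarith

/-- The Weierstrass product inequality. In Janson's inequality it linearises the factors that are
correlated with a given event. -/
theorem one_sub_sum_le_prod_one_sub {ι : Type*} (s : Finset ι) (x : ι → ℝ)
    (h0 : ∀ i, 0 ≤ x i) (h1 : ∀ i, x i ≤ 1) : 1 - ∑ i ∈ s, x i ≤ ∏ i ∈ s, (1 - x i) := by
  classical
  induction s using Finset.induction_on with
  | empty => simp
  | insert i s hi ih =>
    rw [Finset.sum_insert hi, Finset.prod_insert hi]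
    have hs : 0 ≤ ∑ i ∈ s, x i := Finset.sum_nonneg fun j _ => h0 j
    nlinarith [h0 i, h1 i, mul_le_mul_of_nonneg_left ih (sub_nonneg.2 (h1 i)),
      mul_nonneg (h0 i) hs]

/-- **Janson's inequality** for decreasing events, in a form with a free parameter `ρ`. -/
theorem bernoulliExp_prod_one_sub_le {p : E → ℝ} (h0 : ∀ e, 0 ≤ p e) (h1 : ∀ e, p e ≤ 1)
    {ι : Type*} [DecidableEq ι] (I : Finset ι) (b : ι → (E → Bool) → ℝ) (F : ι → Finset E)
    (hb0 : ∀ i ω, 0 ≤ b i ω) (hb1 : ∀ i ω, b i ω ≤ 1) (hb : ∀ i, Antitone (b i))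
    (hF : ∀ i, DependsOn (b i) (F i : Set E)) {ρ : ℝ} (hρ0 : 0 ≤ ρ) (hρ1 : ρ ≤ 1) :
    bernoulliExp p (fun ω => ∏ i ∈ I, (1 - ρ * b i ω)) ≤
      Real.exp (-(ρ * ∑ i ∈ I, bernoulliExp p (b i)) + ρ ^ 2 * ∑ i ∈ I,
        ∑ j ∈ I with ¬ Disjoint (F i) (F j), bernoulliExp p (fun ω => b i ω * b j ω)) := by
  have hx0 : ∀ i ω, 0 ≤ ρ * b i ω := fun i ω => mul_nonneg hρ0 (hb0 i ω)
  have hx1 : ∀ i ω, ρ * b i ω ≤ 1 := fun i ω => mul_le_one₀ hρ1 (hb0 i ω) (hb1 i ω)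
  have hP0 : ∀ (J : Finset ι) ω, 0 ≤ ∏ i ∈ J, (1 - ρ * b i ω) := fun J ω =>
    Finset.prod_nonneg fun i _ => sub_nonneg.2 (hx1 i ω)
  have hPmono : ∀ J : Finset ι, Monotone fun ω => ∏ i ∈ J, (1 - ρ * b i ω) := fun J x y hxy =>
    Finset.prod_le_prod (fun i _ => sub_nonneg.2 (hx1 i x)) fun i _ =>
      sub_le_sub_left (mul_le_mul_of_nonneg_left (hb i hxy) hρ0) _
  induction I using Finset.induction_on with
  | empty => simp [bernoulliExp_const]
  | insert i I hi ih =>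
    -- The factors over `J0` are independent of `b i`; those over `J1` may be correlated with it.
    set J0 := I.filter fun j => Disjoint (F i) (F j)
    set J1 := I.filter fun j => ¬ Disjoint (F i) (F j)
    set d : ι → ℝ := fun j => bernoulliExp p (fun ω => b i ω * b j ω)
    have hd0 : ∀ j, 0 ≤ d j := fun j =>
      bernoulliExp_nonneg h0 h1 fun ω => mul_nonneg (hb0 i ω) (hb0 j ω)
    set P : Finset ι → ℝ := fun J => bernoulliExp p fun ω => ∏ i ∈ J, (1 - ρ * b i ω)
    have hPP0 : ∀ J, 0 ≤ P J := fun J => bernoulliExp_nonneg h0 h1 (hP0 J)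
    have hsplit : ∀ ω, ∏ j ∈ I, (1 - ρ * b j ω) =
        (∏ j ∈ J0, (1 - ρ * b j ω)) * ∏ j ∈ J1, (1 - ρ * b j ω) := fun ω =>
      (Finset.prod_filter_mul_prod_filter_not I _ _).symm
    have hP01 : P I ≤ P J0 := bernoulliExp_mono h0 h1 fun ω => by
      rw [hsplit ω]
      exact mul_le_of_le_one_right (hP0 J0 ω) (Finset.prod_le_one
        (fun j _ => sub_nonneg.2 (hx1 j ω)) fun j _ => by linarith [hx0 j ω])
    -- The product over `J1` is at least one minus a sum. The main term factorises by independence;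
    -- each correction is the decreasing `b i * b j` times an increasing product, which Harris
    -- bounds by `d j * P J0`.
    have hbi : (bernoulliExp p (b i) - ρ * ∑ j ∈ J1, d j) * P J0 ≤
        bernoulliExp p (fun ω => b i ω * ∏ j ∈ I, (1 - ρ * b j ω)) := by
      have hdep : DependsOn (fun ω => ∏ j ∈ J0, (1 - ρ * b j ω)) ((F i : Set E)ᶜ) := by
        intro x y hxy
        refine Finset.prod_congr rfl fun j hj => ?_
        rw [hF j fun e he => hxy e fun hei =>
          Finset.disjoint_left.1 (Finset.mem_filter.1 hj).2 hei he]
      have e1 : bernoulliExp p (fun ω => b i ω * ∏ j ∈ J0, (1 - ρ * b j ω)) =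
          bernoulliExp p (b i) * P J0 :=
        bernoulliExp_mul_of_dependsOn p (hF i) hdep disjoint_compl_right
      have e2 : ∀ j, bernoulliExp p (fun ω => (b i ω * b j ω) * ∏ j ∈ J0, (1 - ρ * b j ω)) ≤
          d j * P J0 := fun j =>
        bernoulliExp_mul_le_of_antitone_of_monotone h0 h1
          (fun x y hxy => mul_le_mul (hb i hxy) (hb j hxy) (hb0 j _) (hb0 i _)) (hPmono J0) (hP0 J0)
      calc (bernoulliExp p (b i) - ρ * ∑ j ∈ J1, d j) * P J0
          = bernoulliExp p (b i) * P J0 - ρ * ∑ j ∈ J1, d j * P J0 := by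
            rw [sub_mul, mul_assoc, Finset.sum_mul]
        _ ≤ bernoulliExp p (fun ω => b i ω * ∏ j ∈ J0, (1 - ρ * b j ω)) -
            ρ * ∑ j ∈ J1,
              bernoulliExp p (fun ω => (b i ω * b j ω) * ∏ j ∈ J0, (1 - ρ * b j ω)) := by
            rw [e1]
            exact sub_le_sub_left (mul_le_mul_of_nonneg_left
              (Finset.sum_le_sum fun j _ => e2 j) hρ0) _
        _ = bernoulliExp p (fun ω => (b i ω * ∏ j ∈ J0, (1 - ρ * b j ω)) *
              (1 - ∑ j ∈ J1, ρ * b j ω)) := by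
            rw [← bernoulliExp_sum, ← bernoulliExp_const_mul, ← bernoulliExp_sub]
            congr 1
            ext ω
            rw [mul_sub, mul_one, ← Finset.mul_sum, ← Finset.sum_mul, ← Finset.mul_sum]
            ring
        _ ≤ _ := by
            refine bernoulliExp_mono h0 h1 fun ω => ?_
            rw [hsplit, ← mul_assoc]
            exact mul_le_mul_of_nonneg_left (one_sub_sum_le_prod_one_sub J1 _
              (fun j => hx0 j ω) fun j => hx1 j ω) (mul_nonneg (hb0 i ω) (hP0 J0 ω))
    have hbi0 : 0 ≤ bernoulliExp p (fun ω => b i ω * ∏ j ∈ I, (1 - ρ * b j ω)) :=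
      bernoulliExp_nonneg h0 h1 fun ω => mul_nonneg (hb0 i ω) (hP0 I ω)
    set c := bernoulliExp p (b i) - ρ * ∑ j ∈ J1, d j
    -- Replacing `P J0` by the smaller `P I` is sound only for `c ≥ 0`; for `c ≤ 0` the left side is
    -- nonpositive.
    have hc : c * P I ≤ bernoulliExp p (fun ω => b i ω * ∏ j ∈ I, (1 - ρ * b j ω)) := by
      rcases le_total 0 c with h | h
      · exact (mul_le_mul_of_nonneg_left hP01 h).trans hbi
      · exact (mul_nonpos_of_nonpos_of_nonneg h (hPP0 I)).trans hbi0
    have step : P (insert i I) ≤ P I * Real.exp (-(ρ * c)) := by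
      have e1 : P (insert i I) =
          P I - ρ * bernoulliExp p (fun ω => b i ω * ∏ j ∈ I, (1 - ρ * b j ω)) := by
        rw [← bernoulliExp_const_mul, ← bernoulliExp_sub]
        simp only [P, Finset.prod_insert hi]
        congr 1
        ext ω
        ring
      have e2 := Real.add_one_le_exp (-(ρ * c))
      nlinarith [mul_le_mul_of_nonneg_left hc hρ0, mul_le_mul_of_nonneg_left e2 (hPP0 I)]
    refine step.trans ((mul_le_mul_of_nonneg_right ih (Real.exp_pos _).le).trans ?_)
    rw [← Real.exp_add, Real.exp_le_exp, Finset.sum_insert hi, Finset.sum_insert hi]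
    have m1 : ∑ j ∈ J1, d j ≤ ∑ j ∈ insert i I with ¬ Disjoint (F i) (F j), d j :=
      Finset.sum_le_sum_of_subset_of_nonneg
        (Finset.filter_subset_filter _ (Finset.subset_insert i I)) fun j _ _ => hd0 j
    have m2 : ∑ k ∈ I, ∑ j ∈ I with ¬ Disjoint (F k) (F j),
          bernoulliExp p (fun ω => b k ω * b j ω) ≤
        ∑ k ∈ I, ∑ j ∈ insert i I with ¬ Disjoint (F k) (F j),
          bernoulliExp p (fun ω => b k ω * b j ω) :=
      Finset.sum_le_sum fun k _ => Finset.sum_le_sum_of_subset_of_nonneg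
        (Finset.filter_subset_filter _ (Finset.subset_insert i I)) fun j _ _ =>
          bernoulliExp_nonneg h0 h1 fun ω => mul_nonneg (hb0 k ω) (hb0 j ω)
    have hρ2 : 0 ≤ ρ ^ 2 := sq_nonneg ρ
    have := mul_le_mul_of_nonneg_left m1 hρ2
    have := mul_le_mul_of_nonneg_left m2 hρ2
    simp only [c]
    nlinarith

/-- **Janson's inequality** for decreasing events: the probability that none of them occurs. -/
theorem bernoulliExp_prod_one_sub_le_exp_neg_sq_div {p : E → ℝ} (h0 : ∀ e, 0 ≤ p e)
    (h1 : ∀ e, p e ≤ 1) {ι : Type*} [DecidableEq ι] (I : Finset ι) (b : ι → (E → Bool) → ℝ)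
    (F : ι → Finset E) (hb0 : ∀ i ω, 0 ≤ b i ω) (hb1 : ∀ i ω, b i ω ≤ 1)
    (hb : ∀ i, Antitone (b i)) (hF : ∀ i, DependsOn (b i) (F i : Set E)) {μ Δ : ℝ} (hμ : 0 < μ)
    (hμI : μ = ∑ i ∈ I, bernoulliExp p (b i)) (hμΔ : μ ≤ Δ)
    (hΔ : ∑ i ∈ I, ∑ j ∈ I with ¬ Disjoint (F i) (F j),
      bernoulliExp p (fun ω => b i ω * b j ω) ≤ Δ) :
    bernoulliExp p (fun ω => ∏ i ∈ I, (1 - b i ω)) ≤ Real.exp (-(μ ^ 2 / (4 * Δ))) := by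
  have hΔ0 : 0 < Δ := hμ.trans_le hμΔ
  -- This ρ minimises -ρμ + ρ²Δ; it is at most 1 because μ ≤ Δ.
  have hρ0 : 0 ≤ μ / (2 * Δ) := by positivity
  have hρ1 : μ / (2 * Δ) ≤ 1 := by rw [div_le_one (by positivity)]; linarith
  have key := bernoulliExp_prod_one_sub_le h0 h1 I b F hb0 hb1 hb hF hρ0 hρ1
  refine le_trans (bernoulliExp_mono h0 h1 fun ω => ?_) (key.trans ?_)
  · refine Finset.prod_le_prod (fun i _ => sub_nonneg.2 (hb1 i ω)) fun i _ => ?_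
    linarith [mul_le_mul_of_nonneg_right hρ1 (hb0 i ω)]
  · rw [Real.exp_le_exp, ← hμI]
    have h2 := mul_le_mul_of_nonneg_left hΔ (sq_nonneg (μ / (2 * Δ)))
    have h3 : -(μ / (2 * Δ) * μ) + (μ / (2 * Δ)) ^ 2 * Δ = -(μ ^ 2 / (4 * Δ)) := by
      field_simp
      ring
    linarith

end Cube

/-! ### Dependent sets as events on the cube of edge indicators -/

section Dependent

variable {V : Type*} [DecidableEq V]

/-- The number of neighbours of `v` in `S`. -/
def degreeIn (S : Finset V) (v : V) (ω : Sym2 V → Bool) : ℕ :=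
  (S.filter fun w => w ≠ v ∧ ω s(v, w) = true).card

/-- Every vertex of `S` has at most `t` neighbours in `S`. -/
def DependentEvent (t : ℝ) (S : Finset V) (ω : Sym2 V → Bool) : Prop :=
  ∀ v ∈ S, (degreeIn S v ω : ℝ) ≤ t

open Classical in
/-- The indicator of `DependentEvent`. -/
noncomputable def dependentInd (t : ℝ) (S : Finset V) (ω : Sym2 V → Bool) : ℝ :=
  if DependentEvent t S ω then 1 else 0

/-- The edges of the complete graph on `S`. -/
def cliqueEdges (S : Finset V) : Finset (Sym2 V) :=
  S.offDiag.image fun x => s(x.1, x.2)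

theorem mem_cliqueEdges {S : Finset V} {v w : V} :
    s(v, w) ∈ cliqueEdges S ↔ v ∈ S ∧ w ∈ S ∧ v ≠ w := by
  simp only [cliqueEdges, Finset.mem_image, Finset.mem_offDiag, Prod.exists, Sym2.eq_iff]
  constructor
  · rintro ⟨a, b, ⟨ha, hb, hab⟩, ⟨rfl, rfl⟩ | ⟨rfl, rfl⟩⟩
    · exact ⟨ha, hb, hab⟩
    · exact ⟨hb, ha, hab.symm⟩
  · exact fun h => ⟨v, w, h, Or.inl ⟨rfl, rfl⟩⟩

theorem card_cliqueEdges (S : Finset V) : (cliqueEdges S).card = S.card.choose 2 :=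
  Sym2.card_image_offDiag S

theorem two_mul_card_cliqueEdges (S : Finset V) :
    2 * ((cliqueEdges S).card : ℝ) = S.card * (S.card - 1) := by
  rw [card_cliqueEdges, Nat.cast_choose_two]
  ring

theorem cliqueEdges_inter (S T : Finset V) :
    cliqueEdges S ∩ cliqueEdges T = cliqueEdges (S ∩ T) := by
  ext e
  induction e with
  | _ v w =>
    simp only [Finset.mem_inter, mem_cliqueEdges]
    tauto

theorem disjoint_cliqueEdges_of_card_lt {S T : Finset V} (h : (S ∩ T).card < 2) :
    Disjoint (cliqueEdges S) (cliqueEdges T) := by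
  rw [Finset.disjoint_iff_inter_eq_empty, cliqueEdges_inter, ← Finset.card_eq_zero,
    card_cliqueEdges, Nat.choose_eq_zero_of_lt h]

theorem degreeIn_mono (S : Finset V) (v : V) : Monotone (degreeIn S v) := fun x y hxy =>
  Finset.card_le_card fun w hw => by
    simp only [Finset.mem_filter] at hw ⊢
    refine ⟨hw.1, hw.2.1, ?_⟩
    have := hxy s(v, w)
    rw [hw.2.2] at this
    exact Bool.eq_true_of_true_le this

theorem DependentEvent.anti {t : ℝ} {S : Finset V} {x y : Sym2 V → Bool}
    (h : DependentEvent t S y) (hxy : x ≤ y) : DependentEvent t S x := fun v hv =>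
  le_trans (Nat.cast_le.2 (degreeIn_mono S v hxy)) (h v hv)

theorem DependentEvent.subset {t : ℝ} {S T : Finset V} {ω : Sym2 V → Bool}
    (h : DependentEvent t T ω) (hST : S ⊆ T) : DependentEvent t S ω := fun v hv =>
  le_trans (Nat.cast_le.2 (Finset.card_le_card (Finset.filter_subset_filter _ hST))) (h v (hST hv))

theorem dependentInd_nonneg (t : ℝ) (S : Finset V) (ω : Sym2 V → Bool) :
    0 ≤ dependentInd t S ω := by
  unfold dependentInd; split_ifs <;> norm_num

theorem dependentInd_le_one (t : ℝ) (S : Finset V) (ω : Sym2 V → Bool) :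
    dependentInd t S ω ≤ 1 := by
  unfold dependentInd; split_ifs <;> norm_num

theorem dependentInd_antitone (t : ℝ) (S : Finset V) : Antitone (dependentInd t S) := by
  intro x y hxy
  unfold dependentInd
  split_ifs with h1 h2
  · rfl
  · exact absurd (h1.anti hxy) h2
  · norm_num
  · rfl

theorem degreeIn_congr {S : Finset V} {v : V} (hv : v ∈ S) {x y : Sym2 V → Bool}
    (h : ∀ e ∈ cliqueEdges S, x e = y e) : degreeIn S v x = degreeIn S v y := by
  unfold degreeIn
  congr 1
  refine Finset.filter_congr fun w hw => and_congr_right fun hwv => ?_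
  rw [h _ (mem_cliqueEdges.2 ⟨hv, hw, hwv.symm⟩)]

theorem dependentEvent_congr {t : ℝ} {S : Finset V} {x y : Sym2 V → Bool}
    (h : ∀ e ∈ cliqueEdges S, x e = y e) : DependentEvent t S x ↔ DependentEvent t S y :=
  forall₂_congr fun v hv => by rw [degreeIn_congr hv h]

theorem dependentInd_dependsOn (t : ℝ) (S : Finset V) :
    DependsOn (dependentInd t S) (cliqueEdges S : Set (Sym2 V)) := fun x y h => by
  have := dependentEvent_congr (t := t) (S := S) (x := x) (y := y) fun e he => h e he
  by_cases hy : DependentEvent t S y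
  · rw [dependentInd, dependentInd, if_pos hy, if_pos (this.2 hy)]
  · rw [dependentInd, dependentInd, if_neg hy, if_neg (mt this.1 hy)]

end Dependent

/-! ### Exponential moments -/

/-- Minus the logarithm of the Laplace transform of a Bernoulli variable. -/
noncomputable def negLogLaplace (p l : ℝ) : ℝ :=
  -Real.log (1 - p + p * Real.exp (-l))

theorem laplace_pos {p : ℝ} (hp0 : 0 ≤ p) (hp1 : p < 1) (l : ℝ) :
    0 < 1 - p + p * Real.exp (-l) :=
  add_pos_of_pos_of_nonneg (by linarith) (mul_nonneg hp0 (Real.exp_pos _).le)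

theorem exp_neg_negLogLaplace {p : ℝ} (hp0 : 0 ≤ p) (hp1 : p < 1) (l : ℝ) :
    Real.exp (-negLogLaplace p l) = 1 - p + p * Real.exp (-l) := by
  rw [negLogLaplace, neg_neg, Real.exp_log (laplace_pos hp0 hp1 l)]

theorem negLogLaplace_nonneg {p : ℝ} (hp0 : 0 ≤ p) (hp1 : p < 1) {l : ℝ} (hl : 0 ≤ l) :
    0 ≤ negLogLaplace p l := by
  rw [negLogLaplace, neg_nonneg]
  refine Real.log_nonpos (laplace_pos hp0 hp1 l).le ?_
  have : Real.exp (-l) ≤ 1 := Real.exp_le_one_iff.2 (by linarith)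
  nlinarith

/-- In a sum of degrees an edge is counted `c` times, once for each end in the set summed over.
Weighting each count by l/2 costs at most L(l)/2 per count: with equality for c = 2, and for c = 1
because the square of a mean is at most the mean of the square. -/
theorem laplace_half_mul_le {p : ℝ} (hp0 : 0 ≤ p) (hp1 : p < 1) (l : ℝ) {c : ℕ} (hc : c ≤ 2) :
    p * Real.exp (-(l / 2) * c) + (1 - p) ≤ Real.exp (-(negLogLaplace p l / 2) * c) := by
  have hM := exp_neg_negLogLaplace hp0 hp1 l
  interval_cases c
  · simp
  · have h1 : Real.exp (-(l / 2) * (1 : ℕ)) ^ 2 = Real.exp (-l) := by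
      rw [← Real.exp_nat_mul]; congr 1; push_cast; ring
    have h2 : Real.exp (-(negLogLaplace p l / 2) * (1 : ℕ)) ^ 2 =
        Real.exp (-negLogLaplace p l) := by
      rw [← Real.exp_nat_mul]; congr 1; push_cast; ring
    refine le_of_sq_le_sq ?_ (Real.exp_pos _).le
    rw [h2, hM, ← h1]
    nlinarith [mul_nonneg (mul_nonneg hp0 (sub_nonneg.2 hp1.le))
      (sq_nonneg (1 - Real.exp (-(l / 2) * (1 : ℕ))))]
  · have h1 : -(l / 2) * ((2 : ℕ) : ℝ) = -l := by push_cast; ring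
    have h2 : -(negLogLaplace p l / 2) * ((2 : ℕ) : ℝ) = -negLogLaplace p l := by push_cast; ring
    rw [h1, h2, hM]
    linarith

/-! ### Exponential moment bounds for one and for two dependent sets -/

section Moment

variable {V : Type*} [DecidableEq V]

/-- The ordered pairs of distinct vertices from `A` and `S`. -/
def crossPairs (A S : Finset V) : Finset (V × V) :=
  (A ×ˢ S).filter fun x => x.2 ≠ x.1

/-- The number of ordered pairs in `crossPairs A S` that span the edge `e`. -/
def crossMult (A S : Finset V) (e : Sym2 V) : ℕ :=
  ((crossPairs A S).filter fun x => s(x.1, x.2) = e).card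

theorem crossMult_le_two (A S : Finset V) (e : Sym2 V) : crossMult A S e ≤ 2 := by
  induction e with
  | _ v w =>
    refine le_trans (Finset.card_le_card (t := {(v, w), (w, v)}) fun x hx => ?_) Finset.card_le_two
    have := (Finset.mem_filter.1 hx).2
    rcases x with ⟨a, b⟩
    simpa [Sym2.eq_iff] using this

variable [Fintype V]

theorem sum_crossMult {A S : Finset V} (h : A ⊆ S) :
    ∑ e, (crossMult A S e : ℝ) = A.card * (S.card - 1) := by
  have h1 : ∑ e, crossMult A S e = (crossPairs A S).card :=
    (Finset.card_eq_sum_card_fiberwise fun x _ => Finset.mem_coe.2 (Finset.mem_univ _)).symm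
  have h2 : (crossPairs A S).card + A.card = A.card * S.card := by
    rw [← Finset.card_product, ← Finset.card_filter_add_card_filter_not (s := A ×ˢ S)
      (fun x => x.2 ≠ x.1)]
    congr 1
    refine Finset.card_bij (fun v _ => (v, v)) (fun v hv => by simp [hv, h hv])
      (fun a _ b _ hab => congrArg Prod.fst hab) fun x hx => ?_
    simp only [Finset.mem_filter, Finset.mem_product, not_not] at hx
    exact ⟨x.1, hx.1.1, Prod.ext rfl hx.2.symm⟩
  have h3 : ((crossPairs A S).card : ℝ) + A.card = A.card * S.card := by exact_mod_cast h2
  rw [← Nat.cast_sum, h1]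
  linarith

/-- Double counting, which turns the exponential of a degree sum into a product over independent
edges. -/
theorem sum_degreeIn (A S : Finset V) (ω : Sym2 V → Bool) :
    ∑ v ∈ A, degreeIn S v ω = ∑ e, crossMult A S e * if ω e then 1 else 0 := by
  have h1 : ∀ v, degreeIn S v ω = ∑ w ∈ S, if w ≠ v ∧ ω s(v, w) = true then 1 else 0 := fun v => by
    rw [degreeIn, Finset.card_filter]
  have h2 : ∀ e, (crossMult A S e * if ω e then 1 else 0) =
      ∑ x ∈ crossPairs A S with s(x.1, x.2) = e, if ω s(x.1, x.2) then 1 else 0 := fun e => by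
    rw [Finset.sum_congr rfl (g := fun _ => if ω e then 1 else 0)
      fun x hx => by rw [(Finset.mem_filter.1 hx).2], Finset.sum_const, smul_eq_mul, crossMult]
  simp only [h1, h2]
  rw [Finset.sum_fiberwise, crossPairs, Finset.sum_filter, Finset.sum_product]
  refine Finset.sum_congr rfl fun v _ => Finset.sum_congr rfl fun w _ => ?_
  by_cases hw : w = v <;> simp [hw]

/-- An upper bound for the indicator of dependence that only involves edges meeting `A`. -/
theorem exists_dependentInd_le {p : ℝ} (hp0 : 0 ≤ p) (hp1 : p < 1) (t : ℝ) {l : ℝ} (hl : 0 ≤ l)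
    {A S : Finset V} (hAS : A ⊆ S) :
    ∃ h : (Sym2 V → Bool) → ℝ, (∀ ω, 0 ≤ h ω) ∧ (∀ ω, dependentInd t S ω ≤ h ω) ∧
      DependsOn h {e | ∃ v ∈ A, v ∈ e} ∧ bernoulliExp (fun _ => p) h ≤
        Real.exp (-(A.card / 2 * ((S.card - 1) * negLogLaplace p l - l * t))) := by
  -- The Markov weight exp((l/2)(|A|t - Σ deg)), with degrees in `S` summed over `A`. It is at least
  -- 1 when `S` is dependent, and edges missing `A` have multiplicity 0 in it.
  refine ⟨fun ω => Real.exp (l / 2 * (A.card * t)) *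
    ∏ e, if ω e then Real.exp (-(l / 2) * crossMult A S e) else 1, fun ω => ?_, fun ω => ?_,
    fun x y hxy => ?_, ?_⟩
  · exact mul_nonneg (Real.exp_pos _).le (Finset.prod_nonneg fun e _ => by
      split_ifs
      · exact (Real.exp_pos _).le
      · exact zero_le_one)
  · have e1 : ∏ e, (if ω e then Real.exp (-(l / 2) * crossMult A S e) else 1) =
        Real.exp (-(l / 2) * ∑ v ∈ A, (degreeIn S v ω : ℝ)) := by
      rw [← Nat.cast_sum, sum_degreeIn, Nat.cast_sum, Finset.mul_sum, Real.exp_sum]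
      refine Finset.prod_congr rfl fun e _ => ?_
      split_ifs <;> simp
    beta_reduce
    rw [e1, ← Real.exp_add]
    unfold dependentInd
    split_ifs with hd
    · rw [Real.one_le_exp_iff]
      have : ∑ v ∈ A, (degreeIn S v ω : ℝ) ≤ A.card * t := by
        rw [← nsmul_eq_mul]
        exact Finset.sum_le_card_nsmul _ _ _ fun v hv => hd v (hAS hv)
      nlinarith
    · exact (Real.exp_pos _).le
  · refine congrArg _ (Finset.prod_congr rfl fun e _ => ?_)
    by_cases he : ∃ v ∈ A, v ∈ e
    · rw [hxy e he]
    · have : crossMult A S e = 0 := by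
        rw [crossMult, Finset.card_eq_zero, Finset.filter_eq_empty_iff]
        rintro x hx rfl
        exact he ⟨x.1, (Finset.mem_product.1 (Finset.mem_filter.1 hx).1).1, Sym2.mem_mk_left _ _⟩
      simp [this]
  · rw [bernoulliExp_const_mul, bernoulliExp_prod (fun _ => p)
      (fun e b => if b then Real.exp (-(l / 2) * crossMult A S e) else 1)]
    have e1 : ∏ e, (p * (if true then Real.exp (-(l / 2) * crossMult A S e) else 1) +
        (1 - p) * (if false then Real.exp (-(l / 2) * crossMult A S e) else 1)) ≤
        ∏ e, Real.exp (-(negLogLaplace p l / 2) * crossMult A S e) := by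
      refine Finset.prod_le_prod (fun e _ => ?_) fun e _ => ?_
      · simp only [if_true, Bool.false_eq_true, if_false, mul_one]
        exact add_nonneg (mul_nonneg hp0 (Real.exp_pos _).le) (by linarith)
      · simpa using laplace_half_mul_le hp0 hp1 l (crossMult_le_two A S e)
    refine (mul_le_mul_of_nonneg_left e1 (Real.exp_pos _).le).trans (le_of_eq ?_)
    rw [← Real.exp_sum, ← Finset.mul_sum, sum_crossMult hAS, ← Real.exp_add]
    congr 1
    ring

/-- The case `A = S`: every edge is counted twice, and this is Chernoff's bound for having at most
|S|t/2 edges. -/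
theorem bernoulliExp_dependentInd_le {p : ℝ} (hp0 : 0 ≤ p) (hp1 : p < 1) (t : ℝ) {l : ℝ}
    (hl : 0 ≤ l) (S : Finset V) : bernoulliExp (fun _ => p) (dependentInd t S) ≤
      Real.exp (-(S.card / 2 * ((S.card - 1) * negLogLaplace p l - l * t))) := by
  obtain ⟨h, -, h1, -, h3⟩ := exists_dependentInd_le hp0 hp1 t hl (Finset.Subset.refl S)
  exact (bernoulliExp_mono (fun _ => hp0) (fun _ => hp1.le) h1).trans h3

/-- Two sets of the same size are dependent with the same probability. -/
theorem bernoulliExp_dependentInd_eq_of_card_eq (p t : ℝ) {S T : Finset V}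
    (h : S.card = T.card) : bernoulliExp (fun _ => p) (dependentInd t S) =
      bernoulliExp (fun _ => p) (dependentInd t T) := by
  -- A bijection from `S` to `T` extends to a permutation of `V`, which acts on edges and preserves
  -- the measure since `p` is constant.
  let τ : Equiv.Perm V := (Finset.equivOfCardEq h).extendSubtype
  have hτ : ∀ v, v ∈ S ↔ τ v ∈ T := fun v => by
    refine ⟨fun hv => Equiv.extendSubtype_mem _ v hv, fun hv => ?_⟩
    by_contra hn
    exact Equiv.extendSubtype_not_mem (Finset.equivOfCardEq h) v hn hv
  have hST : T = S.map τ.toEmbedding := by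
    ext w
    simp only [Finset.mem_map, Equiv.coe_toEmbedding, hτ]
    exact ⟨fun hw => ⟨τ.symm w, by simpa using hw, by simp⟩, by rintro ⟨v, hv, rfl⟩; exact hv⟩
  let σ : Equiv.Perm (Sym2 V) := ⟨Sym2.map τ, Sym2.map τ.symm,
    fun e => by rw [Sym2.map_map]; simp, fun e => by rw [Sym2.map_map]; simp⟩
  let Φ : (Sym2 V → Bool) ≃ (Sym2 V → Bool) := σ.arrowCongr (Equiv.refl Bool)
  have hΦ : ∀ ω v w, Φ ω s(τ v, τ w) = ω s(v, w) := fun ω v w => by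
    simp [Φ, σ, Equiv.arrowCongr]
  symm
  unfold bernoulliExp
  rw [← Φ.sum_comp]
  refine Finset.sum_congr rfl fun ω _ => ?_
  congr 1
  · unfold bernoulliWeight
    rw [← Equiv.prod_comp σ]
    refine Finset.prod_congr rfl fun e _ => ?_
    simp [Φ, Equiv.arrowCongr]
  · have : DependentEvent t T (Φ ω) ↔ DependentEvent t S ω := by
      unfold DependentEvent degreeIn
      rw [hST]
      simp only [Finset.forall_mem_map, Equiv.coe_toEmbedding, Finset.filter_map, Finset.card_map,
        Function.comp_def, hΦ, ne_eq, EmbeddingLike.apply_eq_iff_eq]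
    by_cases hy : DependentEvent t S ω
    · rw [dependentInd, dependentInd, if_pos hy, if_pos (this.2 hy)]
    · rw [dependentInd, dependentInd, if_neg hy, if_neg (mt this.1 hy)]

/-- A set that spans no edge is dependent for every t ≥ 0. -/
theorem pow_le_bernoulliExp_dependentInd {p : ℝ} (hp0 : 0 ≤ p) (hp1 : p < 1) {t : ℝ} (ht : 0 ≤ t)
    (S : Finset V) : (1 - p) ^ (cliqueEdges S).card ≤
      bernoulliExp (fun _ => p) (dependentInd t S) := by
  have key := bernoulliExp_prod (fun _ : Sym2 V => p)
    (fun e b => if e ∈ cliqueEdges S then (if b then 0 else 1) else 1)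
  have h1 : ∏ e : Sym2 V, (p * (if e ∈ cliqueEdges S then (if true then 0 else 1) else 1) +
      (1 - p) * (if e ∈ cliqueEdges S then (if false then 0 else 1) else 1)) =
      (1 - p) ^ (cliqueEdges S).card := by
    rw [← Finset.prod_const, ← Finset.prod_subset (Finset.subset_univ (cliqueEdges S))]
    · exact Finset.prod_congr rfl fun e he => by simp [he]
    · intro e _ he
      simp [he]
  rw [← h1]
  refine key.symm.le.trans (bernoulliExp_mono (fun _ => hp0) (fun _ => hp1.le) fun ω => ?_)
  by_cases h : ∀ e ∈ cliqueEdges S, ω e = false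
  · have hd : DependentEvent t S ω := by
      rw [dependentEvent_congr (y := fun _ => false) h]
      intro v _
      simpa [degreeIn] using ht
    rw [dependentInd, if_pos hd]
    exact Finset.prod_le_one (fun e _ => by split_ifs <;> norm_num)
      fun e _ => by split_ifs <;> norm_num
  · push Not at h
    obtain ⟨e, he, hω⟩ := h
    rw [Finset.prod_eq_zero (Finset.mem_univ e) (by simp [he, hω])]
    exact dependentInd_nonneg t S ω

/-- Joint dependence of two overlapping sets, in terms of the edges of the second outside the
overlap. -/
theorem bernoulliExp_dependentInd_mul_le_exp {p : ℝ} (hp0 : 0 ≤ p) (hp1 : p < 1) (t : ℝ) {l : ℝ}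
    (hl : 0 ≤ l) (S T : Finset V) :
    bernoulliExp (fun _ => p) (fun ω => dependentInd t S ω * dependentInd t T ω) ≤
      bernoulliExp (fun _ => p) (dependentInd t S) *
        Real.exp (-((T \ S).card / 2 * ((T.card - 1) * negLogLaplace p l - l * t))) := by
  -- With `A = T \ S` the majorant of the event for `T` uses no edge inside `S`, hence is
  -- independent of the event for `S`.
  obtain ⟨h, -, h1, h2, h3⟩ :=
    exists_dependentInd_le hp0 hp1 t hl (Finset.sdiff_subset : T \ S ⊆ T)
  have hdisj : Disjoint (cliqueEdges S : Set (Sym2 V)) {e | ∃ v ∈ T \ S, v ∈ e} := by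
    rw [Set.disjoint_left]
    rintro e he ⟨v, hv, hve⟩
    induction e with
    | _ a b =>
      rw [Finset.mem_coe, mem_cliqueEdges] at he
      rw [Finset.mem_sdiff] at hv
      rcases Sym2.mem_iff.1 hve with rfl | rfl
      · exact hv.2 he.1
      · exact hv.2 he.2.1
  calc _ ≤ bernoulliExp (fun _ => p) (fun ω => dependentInd t S ω * h ω) :=
        bernoulliExp_mono (fun _ => hp0) (fun _ => hp1.le) fun ω =>
          mul_le_mul_of_nonneg_left (h1 ω) (dependentInd_nonneg t S ω)
    _ = bernoulliExp (fun _ => p) (dependentInd t S) * bernoulliExp (fun _ => p) h :=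
        bernoulliExp_mul_of_dependsOn _ (dependentInd_dependsOn t S) h2 hdisj
    _ ≤ _ := mul_le_mul_of_nonneg_left h3 (bernoulliExp_nonneg (fun _ => hp0) (fun _ => hp1.le)
        (dependentInd_nonneg t S))

/-- Joint dependence of two overlapping sets: the overlap costs at most the probability that it
spans no edge. -/
theorem bernoulliExp_dependentInd_mul_le_div {p : ℝ} (hp0 : 0 ≤ p) (hp1 : p < 1) (t : ℝ)
    (S T : Finset V) :
    bernoulliExp (fun _ => p) (fun ω => dependentInd t S ω * dependentInd t T ω) ≤
      bernoulliExp (fun _ => p) (dependentInd t S) *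
        (bernoulliExp (fun _ => p) (dependentInd t T) /
          (1 - p) ^ (cliqueEdges (S ∩ T)).card) := by
  set O := cliqueEdges (S ∩ T)
  have hq : 0 < 1 - p := by linarith
  -- `z` deletes the edges of the overlap and `f` indicates that there are none. Deletion only helps
  -- dependence and decouples `T` from `S`; since `z ω = ω` where `f` is 1, the mean of `g` exceeds
  -- that of `dependentInd t T` by at most the factor (1-p)^(-|O|).
  let z : (Sym2 V → Bool) → (Sym2 V → Bool) := fun ω e => if e ∈ O then false else ω e
  let g : (Sym2 V → Bool) → ℝ := fun ω => dependentInd t T (z ω)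
  let f : (Sym2 V → Bool) → ℝ := fun ω => ∏ e, if e ∈ O then (if ω e then 0 else 1) else 1
  have hz : ∀ ω, z ω ≤ ω := fun ω e => by
    simp only [z]; split_ifs
    · exact Bool.false_le _
    · exact le_rfl
  have hgdep : DependsOn g ((cliqueEdges T \ O : Finset (Sym2 V)) : Set (Sym2 V)) := by
    intro x y hxy
    refine dependentInd_dependsOn t T fun e he => ?_
    by_cases heO : e ∈ O
    · simp [z, heO]
    · simp only [z, heO, if_false]
      exact hxy e (by simp [heO, Finset.mem_coe.1 he])
  have hfdep : DependsOn f (O : Set (Sym2 V)) := by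
    intro x y hxy
    refine Finset.prod_congr rfl fun e _ => ?_
    by_cases heO : e ∈ O
    · simp [heO, hxy e heO]
    · simp [heO]
  have hO : O = cliqueEdges S ∩ cliqueEdges T := (cliqueEdges_inter S T).symm
  have hfexp : bernoulliExp (fun _ => p) f = (1 - p) ^ O.card := by
    have := bernoulliExp_prod (fun _ : Sym2 V => p)
      (fun e b => if e ∈ O then (if b then 0 else 1) else 1)
    refine this.trans ?_
    rw [← Finset.prod_const, ← Finset.prod_subset (Finset.subset_univ O)]
    · exact Finset.prod_congr rfl fun e he => by simp [he]
    · intro e _ he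
      simp [he]
  have hg : bernoulliExp (fun _ => p) g * (1 - p) ^ O.card ≤
      bernoulliExp (fun _ => p) (dependentInd t T) := by
    rw [← hfexp, ← bernoulliExp_mul_of_dependsOn _ hgdep hfdep]
    · refine bernoulliExp_mono (fun _ => hp0) (fun _ => hp1.le) fun ω => ?_
      by_cases h : ∀ e ∈ O, ω e = false
      · have : z ω = ω := funext fun e => by
          by_cases he : e ∈ O
          · simp [z, he, h e he]
          · simp [z, he]
        simp only [g, this]
        exact mul_le_of_le_one_right (dependentInd_nonneg t T ω)
          (Finset.prod_le_one (fun e _ => by split_ifs <;> norm_num)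
            fun e _ => by split_ifs <;> norm_num)
      · push Not at h
        obtain ⟨e, he, hω⟩ := h
        have : f ω = 0 := Finset.prod_eq_zero (Finset.mem_univ e) (by simp [he, hω])
        rw [this, mul_zero]
        exact dependentInd_nonneg t T ω
    · rw [Finset.disjoint_coe]
      exact Finset.sdiff_disjoint
  calc _ ≤ bernoulliExp (fun _ => p) (fun ω => dependentInd t S ω * g ω) :=
        bernoulliExp_mono (fun _ => hp0) (fun _ => hp1.le) fun ω =>
          mul_le_mul_of_nonneg_left (dependentInd_antitone t T (hz ω)) (dependentInd_nonneg t S ω)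
    _ = bernoulliExp (fun _ => p) (dependentInd t S) * bernoulliExp (fun _ => p) g := by
        refine bernoulliExp_mul_of_dependsOn _ (dependentInd_dependsOn t S) hgdep ?_
        rw [Finset.disjoint_coe, hO, Finset.disjoint_left]
        intro e he he'
        simp only [Finset.mem_sdiff, Finset.mem_inter, not_and] at he'
        exact he'.2 he he'.1
    _ ≤ _ := mul_le_mul_of_nonneg_left ((le_div_iff₀ (pow_pos hq _)).2 hg)
        (bernoulliExp_nonneg (fun _ => hp0) (fun _ => hp1.le) (dependentInd_nonneg t S))

end Moment

/-! ### Tail bounds -/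

section Tail

variable {E : Type*} [Fintype E] [DecidableEq E]

/-- The number of edges of `F` that are present. -/
def edgeCount (F : Finset E) (ω : E → Bool) : ℕ :=
  (F.filter fun e => ω e = true).card

/-- Per edge, e^x ≤ 1 + x + x² for |x| ≤ 1; centring cancels the linear terms and q(1-q) ≤ 1.
Probabilities are prescribed on `F` only, so that the bound also applies under a tilted measure. -/
theorem bernoulliExp_exp_edgeCount_le {p : E → ℝ} {q : ℝ} (hq0 : 0 ≤ q) (hq1 : q ≤ 1)
    (F : Finset E) (hF : ∀ e ∈ F, p e = q) {l : ℝ} (hl : |l| ≤ 1) :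
    bernoulliExp p (fun ω => Real.exp (l * (edgeCount F ω - q * F.card))) ≤
      Real.exp (l ^ 2 * F.card) := by
  have e1 : ∀ ω : E → Bool, Real.exp (l * (edgeCount F ω - q * F.card)) =
      ∏ e, (fun (e : E) (b : Bool) => if e ∈ F then
        (if b then Real.exp (l * (1 - q)) else Real.exp (-(l * q))) else 1) e (ω e) := fun ω => by
    have : (edgeCount F ω : ℝ) - q * F.card =
        ∑ e ∈ F, ((if ω e = true then (1 : ℝ) else 0) - q) := by
      rw [Finset.sum_sub_distrib, Finset.sum_const, nsmul_eq_mul, edgeCount, Finset.card_filter]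
      push_cast
      ring
    rw [this, Finset.mul_sum, Real.exp_sum, ← Finset.prod_subset (Finset.subset_univ F)]
    · refine Finset.prod_congr rfl fun e he => ?_
      simp only [he, if_true]
      split_ifs
      · rfl
      · congr 1; ring
    · intro e _ he
      simp [he]
  simp only [e1]
  rw [bernoulliExp_prod p (fun (e : E) (b : Bool) => if e ∈ F then
        (if b then Real.exp (l * (1 - q)) else Real.exp (-(l * q))) else 1)]
  have e2 : Real.exp (l ^ 2 * F.card) = ∏ e ∈ F, Real.exp (l ^ 2) := by
    rw [Finset.prod_const, ← Real.exp_nat_mul, mul_comm]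
  rw [e2, ← Finset.prod_subset (Finset.subset_univ F)]
  · refine Finset.prod_le_prod (fun e he => ?_) fun e he => ?_
    · simp only [he, if_true, hF e he, Bool.false_eq_true, if_false]
      exact add_nonneg (mul_nonneg hq0 (Real.exp_pos _).le)
        (mul_nonneg (by linarith) (Real.exp_pos _).le)
    · simp only [he, if_true, hF e he, Bool.false_eq_true, if_false]
      have hl1 : |l * (1 - q)| ≤ 1 := by
        rw [abs_mul, abs_of_nonneg (sub_nonneg.2 hq1)]
        exact mul_le_one₀ hl (sub_nonneg.2 hq1) (by linarith)
      have hl2 : |-(l * q)| ≤ 1 := by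
        rw [abs_neg, abs_mul, abs_of_nonneg hq0]
        exact mul_le_one₀ hl hq0 hq1
      have a1 := (abs_le.1 (Real.abs_exp_sub_one_sub_id_le hl1)).2
      have a2 := (abs_le.1 (Real.abs_exp_sub_one_sub_id_le hl2)).2
      have a3 := Real.add_one_le_exp (l ^ 2)
      have a4 : q * (1 - q) ≤ 1 := by nlinarith
      calc q * Real.exp (l * (1 - q)) + (1 - q) * Real.exp (-(l * q))
          ≤ q * (1 + l * (1 - q) + (l * (1 - q)) ^ 2) + (1 - q) * (1 + -(l * q) + (-(l * q)) ^ 2) :=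
            add_le_add (mul_le_mul_of_nonneg_left (by linarith) hq0)
              (mul_le_mul_of_nonneg_left (by linarith) (sub_nonneg.2 hq1))
        _ = 1 + l ^ 2 * (q * (1 - q)) := by ring
        _ ≤ 1 + l ^ 2 * 1 := by gcongr
        _ ≤ _ := by linarith
  · intro e _ he
    simp [he]

open Classical in
/-- Chernoff's bound for the number of edges of `F`, for both tails. -/
theorem bernoulliExp_tail_le {p : E → ℝ} (h0 : ∀ e, 0 ≤ p e) (h1 : ∀ e, p e ≤ 1) {q : ℝ}
    (hq0 : 0 ≤ q) (hq1 : q ≤ 1) (F : Finset E) (hF : ∀ e ∈ F, p e = q) {l s : ℝ} (hl : |l| ≤ 1) :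
    bernoulliExp p (fun ω => if l * s ≤ l * (edgeCount F ω - q * F.card) then 1 else 0) ≤
      Real.exp (-(l * s) + l ^ 2 * F.card) := by
  rw [Real.exp_add]
  refine le_trans ?_ (mul_le_mul_of_nonneg_left
    (bernoulliExp_exp_edgeCount_le hq0 hq1 F hF hl) (Real.exp_pos _).le)
  rw [← bernoulliExp_const_mul]
  refine bernoulliExp_mono h0 h1 fun ω => ?_
  rw [← Real.exp_add]
  split_ifs with h
  · rw [Real.one_le_exp_iff]
    linarith
  · exact (Real.exp_pos _).le

end Tail

/-! ### Degree tails and the tilted measure -/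

section LowerBound

variable {V : Type*} [DecidableEq V]

/-- The edges from `v` to the other vertices of `S`. -/
def starEdges (S : Finset V) (v : V) : Finset (Sym2 V) :=
  (S.erase v).image fun w => s(v, w)

theorem degreeIn_eq_edgeCount [Fintype V] (S : Finset V) (v : V) (ω : Sym2 V → Bool) :
    degreeIn S v ω = edgeCount (starEdges S v) ω := by
  have hinj : Function.Injective fun w : V => s(v, w) := fun a b h => by
    simpa using Sym2.congr_right.1 h
  rw [edgeCount, starEdges, Finset.filter_image, Finset.card_image_of_injective _ hinj, degreeIn]
  congr 1
  ext w
  simp only [Finset.mem_filter, Finset.mem_erase]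
  tauto

theorem card_starEdges_le (S : Finset V) (v : V) : (starEdges S v).card ≤ S.card :=
  Finset.card_image_le.trans (Finset.card_le_card (Finset.erase_subset _ _))

theorem starEdges_subset {S : Finset V} {v : V} (hv : v ∈ S) : starEdges S v ⊆ cliqueEdges S := by
  intro e he
  obtain ⟨w, hw, rfl⟩ := Finset.mem_image.1 he
  exact mem_cliqueEdges.2 ⟨hv, Finset.mem_of_mem_erase hw, (Finset.ne_of_mem_erase hw).symm⟩

variable [Fintype V]

-- Chernoff with parameter σ/2: the exponent -σ²k/2 + σ²|F|/4, where `F` is the star of at most k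
-- edges, is at most -σ²k/4. Used both under the tilted measure and for colouring by blocks.
open Classical in
theorem bernoulliExp_degreeIn_tail_le {p : Sym2 V → ℝ} (h0 : ∀ e, 0 ≤ p e) (h1 : ∀ e, p e ≤ 1)
    {q : ℝ} (hq0 : 0 ≤ q) (hq1 : q ≤ 1) (S : Finset V) (v : V)
    (hF : ∀ e ∈ starEdges S v, p e = q) {k σ t : ℝ} (hσ0 : 0 ≤ σ) (hσ1 : σ ≤ 1)
    (hk : (S.card : ℝ) ≤ k) (ht : (q + σ) * k ≤ t) :
    bernoulliExp p (fun ω => if t < degreeIn S v ω then 1 else 0) ≤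
      Real.exp (-(σ ^ 2 / 4 * k)) := by
  have hc : ((starEdges S v).card : ℝ) ≤ k := (Nat.cast_le.2 (card_starEdges_le S v)).trans hk
  have key := bernoulliExp_tail_le h0 h1 hq0 hq1 (starEdges S v) hF (l := σ / 2) (s := σ * k)
    (by rw [abs_of_nonneg (by linarith)]; linarith)
  refine (bernoulliExp_mono h0 h1 fun ω => ?_).trans (key.trans (Real.exp_le_exp.2 ?_))
  · by_cases h : t < degreeIn S v ω
    · rw [if_pos h, if_pos]
      rw [degreeIn_eq_edgeCount] at h
      refine mul_le_mul_of_nonneg_left ?_ (by linarith)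
      nlinarith [mul_le_mul_of_nonneg_left hc hq0]
    · rw [if_neg h]
      split_ifs <;> norm_num
  · nlinarith [mul_le_mul_of_nonneg_left hc (sq_nonneg σ)]

/-- Exponential tilting of the edge probabilities on `F`. -/
theorem bernoulliExp_tilt_le {E : Type*} [Fintype E] [DecidableEq E] {p : ℝ} (hp0 : 0 < p)
    (hp1 : p < 1) {l q : ℝ} (hl : 0 ≤ l)
    (hq : q = p * Real.exp (-l) / (1 - p + p * Real.exp (-l))) (F : Finset E)
    {f g : (E → Bool) → ℝ} {y : ℝ} (hf : ∀ ω, 0 ≤ f ω) (hfg : ∀ ω, g ω ≤ f ω)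
    (hy : ∀ ω, (edgeCount F ω : ℝ) < y → g ω ≤ 0) :
    Real.exp (-(F.card * negLogLaplace p l) + l * y) *
      bernoulliExp (fun e => if e ∈ F then q else p) g ≤ bernoulliExp (fun _ => p) f := by
  have hM := laplace_pos hp0.le hp1 l
  have hq1 : 1 - q = (1 - p) / (1 - p + p * Real.exp (-l)) := by
    rw [hq]; field_simp; ring
  have hq0 : 0 ≤ q := by rw [hq]; positivity
  have hq1' : q ≤ 1 := by
    have : 0 ≤ 1 - q := by rw [hq1]; exact div_nonneg (by linarith) hM.le
    linarith
  have hp'0 : ∀ e, 0 ≤ (fun e => if e ∈ F then q else p) e := fun e => by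
    dsimp only; split_ifs <;> linarith
  have hp'1 : ∀ e, (fun e => if e ∈ F then q else p) e ≤ 1 := fun e => by
    dsimp only; split_ifs <;> linarith
  -- The density of the original measure with respect to the tilted one. It increases with the
  -- number of edges in `F`, so it is at least the claimed prefactor when there are `y` or more
  -- edges; with fewer, `g` is nonpositive.
  have hw : ∀ ω : E → Bool, bernoulliWeight (fun _ => p) ω =
      bernoulliWeight (fun e => if e ∈ F then q else p) ω *
        Real.exp (-(F.card * negLogLaplace p l) + l * edgeCount F ω) := fun ω => by
    have e1 : Real.exp (-(F.card * negLogLaplace p l) + l * edgeCount F ω) =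
        ∏ e, if e ∈ F then (1 - p + p * Real.exp (-l)) * (if ω e then Real.exp l else 1) else 1 := by
      rw [← Finset.prod_subset (Finset.subset_univ F) fun e _ he => by simp [he],
        Finset.prod_congr rfl (g := fun e => Real.exp (-negLogLaplace p l) *
          (if ω e then Real.exp l else 1)) fun e he => by
            rw [if_pos he, exp_neg_negLogLaplace hp0.le hp1], Finset.prod_mul_distrib,
        Finset.prod_const, ← Real.exp_nat_mul, Real.exp_add, ← Finset.prod_filter,
        Finset.prod_const, ← Real.exp_nat_mul]
      congr 2
      · ring
      · rw [edgeCount]; ring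
    rw [e1, bernoulliWeight, bernoulliWeight, ← Finset.prod_mul_distrib]
    refine Finset.prod_congr rfl fun e _ => ?_
    by_cases he : e ∈ F
    · simp only [he, if_true]
      split_ifs
      · rw [hq, div_mul_eq_mul_div, eq_div_iff hM.ne', mul_right_comm]
        rw [← mul_assoc, mul_comm (p * _)]
        have : Real.exp (-l) * Real.exp l = 1 := by rw [← Real.exp_add]; simp
        linear_combination (-(p * (1 - p + p * Real.exp (-l)))) * this
      · rw [hq1]; field_simp
    · simp [he]
  rw [← bernoulliExp_const_mul]
  refine Finset.sum_le_sum fun ω _ => ?_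
  rw [hw ω, mul_assoc]
  refine mul_le_mul_of_nonneg_left ?_ (bernoulliWeight_nonneg hp'0 hp'1 ω)
  rcases lt_or_ge (edgeCount F ω : ℝ) y with h | h
  · exact (mul_nonpos_of_nonneg_of_nonpos (Real.exp_pos _).le (hy ω h)).trans
      (mul_nonneg (Real.exp_pos _).le (hf ω))
  · refine (mul_le_mul_of_nonneg_left (hfg ω) (Real.exp_pos _).le).trans
      (mul_le_mul_of_nonneg_right (Real.exp_le_exp.2 ?_) (hf ω))
    have := mul_le_mul_of_nonneg_left h hl
    linarith

open Classical in
/-- With tilted edge probabilities, a set is dependent with probability at least one half. -/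
theorem bernoulliExp_dependentInd_ge_of_tilt {p : ℝ} (hp0 : 0 < p) (hp1 : p < 1) {l q : ℝ}
    (hl : 0 ≤ l) (hq : q = p * Real.exp (-l) / (1 - p + p * Real.exp (-l))) (hq0 : 0 ≤ q)
    (hq1 : q ≤ 1) {σ t : ℝ} (hσ0 : 0 ≤ σ) (hσ1 : σ ≤ 1) (S : Finset V)
    (ht : (q + σ) * S.card ≤ t) (hk : 3 ≤ S.card)
    (hkσ : (S.card + 1) * Real.exp (-(σ ^ 2 / 4 * S.card)) ≤ 1 / 2) :
    Real.exp (-((cliqueEdges S).card * (negLogLaplace p l - l * (q - σ)))) * (1 / 2) ≤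
      bernoulliExp (fun _ => p) (dependentInd t S) := by
  set F := cliqueEdges S
  set p' : Sym2 V → ℝ := fun e => if e ∈ F then q else p
  have hp'0 : ∀ e, 0 ≤ p' e := fun e => by dsimp only [p']; split_ifs <;> linarith
  have hp'1 : ∀ e, p' e ≤ 1 := fun e => by dsimp only [p']; split_ifs <;> linarith
  -- One minus the indicators of the bad events: some degree exceeds `t`, or at most (q-σ)|F| edges
  -- are present. Under the tilted measure these |S| + 1 events have total probability at most 1/2.
  let g : (Sym2 V → Bool) → ℝ := fun ω => 1 -
    (∑ v ∈ S, (if t < degreeIn S v ω then 1 else 0) +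
      if -(σ / 2) * -(σ * F.card) ≤ -(σ / 2) * (edgeCount F ω - q * F.card) then 1 else 0)
  have hsum0 : ∀ ω, (0 : ℝ) ≤ ∑ v ∈ S, (if t < (degreeIn S v ω : ℝ) then 1 else 0) := fun ω =>
    Finset.sum_nonneg fun v _ => by split_ifs <;> norm_num
  have key := bernoulliExp_tilt_le hp0 hp1 hl hq F (f := dependentInd t S) (g := g)
    (y := (q - σ) * F.card) (dependentInd_nonneg t S) (fun ω => ?_) fun ω hω => ?_
  -- Three vertices suffice for this; it makes the tail of the edge count no larger than the bound
  -- for a degree.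
  · have hkF : (S.card : ℝ) ≤ F.card := by
      have := two_mul_card_cliqueEdges S
      have h3 : (3 : ℝ) ≤ S.card := by exact_mod_cast hk
      nlinarith
    have e1 : 1 / 2 ≤ bernoulliExp p' g := by
      have t1 : ∀ v ∈ S, bernoulliExp p' (fun ω => if t < (degreeIn S v ω : ℝ) then 1 else 0) ≤
          Real.exp (-(σ ^ 2 / 4 * S.card)) := fun v hv =>
        bernoulliExp_degreeIn_tail_le hp'0 hp'1 hq0 hq1 S v
          (fun e he => if_pos (starEdges_subset hv he)) hσ0 hσ1 le_rfl ht
      have t2 := bernoulliExp_tail_le hp'0 hp'1 hq0 hq1 F (fun e he => if_pos he)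
        (l := -(σ / 2)) (s := -(σ * F.card))
        (by rw [abs_neg, abs_of_nonneg (by linarith)]; linarith)
      have t3 : Real.exp (-(-(σ / 2) * -(σ * F.card)) + (-(σ / 2)) ^ 2 * F.card) ≤
          Real.exp (-(σ ^ 2 / 4 * S.card)) := by
        rw [Real.exp_le_exp]
        nlinarith [mul_le_mul_of_nonneg_left hkF (sq_nonneg σ)]
      have t4 := Finset.sum_le_card_nsmul S _ _ t1
      rw [nsmul_eq_mul] at t4
      simp only [g]
      rw [bernoulliExp_sub, bernoulliExp_const, bernoulliExp_add, bernoulliExp_sum]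
      linarith
    refine le_trans ?_ key
    have e2 : -((F.card : ℝ) * (negLogLaplace p l - l * (q - σ))) =
        -(F.card * negLogLaplace p l) + l * ((q - σ) * F.card) := by ring
    rw [e2]
    exact mul_le_mul_of_nonneg_left e1 (Real.exp_pos _).le
  · by_cases hd : DependentEvent t S ω
    · rw [dependentInd, if_pos hd]
      have : (0 : ℝ) ≤ if -(σ / 2) * -(σ * F.card) ≤ -(σ / 2) * (edgeCount F ω - q * F.card)
        then 1 else 0 := by split_ifs <;> norm_num
      simp only [g]
      linarith [hsum0 ω]
    · rw [dependentInd, if_neg hd]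
      unfold DependentEvent at hd
      push Not at hd
      obtain ⟨v, hv, hvt⟩ := hd
      have h1 := Finset.single_le_sum (s := S)
        (f := fun v => if t < (degreeIn S v ω : ℝ) then (1 : ℝ) else 0)
        (fun v _ => by split_ifs <;> norm_num) hv
      simp only [hvt, if_true] at h1
      have : (0 : ℝ) ≤ if -(σ / 2) * -(σ * F.card) ≤ -(σ / 2) * (edgeCount F ω - q * F.card)
        then 1 else 0 := by split_ifs <;> norm_num
      simp only [g]
      linarith
  · simp only [g]
    rw [if_pos (by nlinarith)]
    linarith [hsum0 ω]

end LowerBound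

/-! ### The function `κ` -/

section Kappa

theorem negLogLaplace_zero (p : ℝ) : negLogLaplace p 0 = 0 := by
  simp [negLogLaplace]

theorem negLogLaplace_pos {p : ℝ} (hp0 : 0 < p) (hp1 : p < 1) {l : ℝ} (hl : 0 < l) :
    0 < negLogLaplace p l := by
  rw [negLogLaplace, neg_pos]
  refine Real.log_neg (laplace_pos hp0.le hp1 l) ?_
  have : Real.exp (-l) < 1 := by rw [Real.exp_lt_one_iff]; linarith
  nlinarith

theorem negLogLaplace_le_neg_log {p : ℝ} (hp0 : 0 ≤ p) (hp1 : p < 1) (l : ℝ) :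
    negLogLaplace p l ≤ -Real.log (1 - p) := by
  rw [negLogLaplace, neg_le_neg_iff]
  refine Real.log_le_log (by linarith) ?_
  linarith [mul_nonneg hp0 (Real.exp_pos (-l)).le]

theorem negLogLaplace_le_mul {p : ℝ} (hp0 : 0 ≤ p) (hp1 : p < 1) (l : ℝ) :
    negLogLaplace p l ≤ p * l := by
  have h : -(p * l) ≤ Real.log (1 - p + p * Real.exp (-l)) := by
    rw [Real.le_log_iff_exp_le (laplace_pos hp0 hp1 l)]
    have := convexOn_exp.2 (Set.mem_univ 0) (Set.mem_univ (-l)) (sub_nonneg.2 hp1.le) hp0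
      (by ring)
    simpa using this
  rw [negLogLaplace]
  linarith

/-- The tangent-line bound for `negLogLaplace`. -/
theorem mul_tilt_le_negLogLaplace {p : ℝ} (hp0 : 0 < p) (hp1 : p < 1) (l : ℝ) :
    l * (p * Real.exp (-l) / (1 - p + p * Real.exp (-l))) ≤ negLogLaplace p l := by
  have hM := laplace_pos hp0.le hp1 l
  set M := 1 - p + p * Real.exp (-l)
  have h0 : 0 ≤ p * Real.exp (-l) / M := by positivity
  have h1 : 1 - p * Real.exp (-l) / M = (1 - p) / M := by
    field_simp
    simp only [M]
    ring
  have h2 : 0 ≤ (1 - p) / M := div_nonneg (by linarith) hM.le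
  -- Jensen for the exponential of l times a tilted Bernoulli variable, whose mean is 1/M.
  have := convexOn_exp.2 (Set.mem_univ 0) (Set.mem_univ l) h2 h0 (by rw [← h1]; ring)
  have h3 : (1 - p) / M * 1 + p * Real.exp (-l) / M * Real.exp l = 1 / M := by
    have : Real.exp (-l) * Real.exp l = 1 := by rw [← Real.exp_add]; simp
    field_simp
    linear_combination p * this
  simp only [smul_eq_mul, mul_zero, zero_add, Real.exp_zero, h3] at this
  have h4 : p * Real.exp (-l) / M * l ≤ Real.log (1 / M) :=
    (Real.le_log_iff_exp_le (by positivity)).2 this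
  rw [one_div, Real.log_inv] at h4
  rw [mul_comm]
  exact h4

theorem tendsto_negLogLaplace_atTop {p : ℝ} (hp1 : p < 1) :
    Tendsto (negLogLaplace p) atTop (𝓝 (-Real.log (1 - p))) := by
  have h1 : Tendsto (fun l : ℝ => 1 - p + p * Real.exp (-l)) atTop (𝓝 (1 - p + p * 0)) :=
    tendsto_const_nhds.add (Real.tendsto_exp_neg_atTop_nhds_zero.const_mul p)
  rw [mul_zero, add_zero] at h1
  exact (h1.log (by linarith)).neg

theorem hasDerivAt_negLogLaplace_zero (p : ℝ) : HasDerivAt (negLogLaplace p) p 0 := by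
  have h1 : HasDerivAt (fun l : ℝ => 1 - p + p * Real.exp (-l)) (-p) 0 := by
    have := (((Real.hasDerivAt_exp (-0)).comp (0 : ℝ) (hasDerivAt_neg 0)).const_mul p).const_add
      (1 - p)
    simpa using this
  have h2 := (h1.log (by simp)).neg
  simp only [neg_zero, Real.exp_zero, mul_one, sub_add_cancel, div_one, neg_neg] at h2
  exact h2

/-- Near zero, `negLogLaplace p l` is almost `p * l`. -/
theorem exists_mul_le_negLogLaplace {p c : ℝ} (hc : c < p) :
    ∃ l, 0 < l ∧ c * l ≤ negLogLaplace p l := by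
  have h := (hasDerivAt_negLogLaplace_zero p).tendsto_slope_zero_right
  simp only [zero_add, negLogLaplace_zero, sub_zero, smul_eq_mul] at h
  obtain ⟨l, hl, hl0⟩ := ((h.eventually (lt_mem_nhds hc)).and self_mem_nhdsWithin).exists
  have hl0 : 0 < l := hl0
  refine ⟨l, hl0, ?_⟩
  rw [inv_mul_eq_div, lt_div_iff₀ hl0] at hl
  exact hl.le

/-- The function `κ`: the largest `(τ ln n)`-dependent sets of `G(n, p)` have size about
`κ τ * ln n`. -/
noncomputable def kappa (p τ : ℝ) : ℝ :=
  ⨅ l : Set.Ioi (0 : ℝ), (2 + l * τ) / negLogLaplace p l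

variable {p : ℝ}

theorem kappa_term_nonneg (hp0 : 0 < p) (hp1 : p < 1) {τ : ℝ} (hτ : 0 ≤ τ) (l : Set.Ioi (0 : ℝ)) :
    0 ≤ (2 + l * τ) / negLogLaplace p l :=
  div_nonneg (by nlinarith [mul_nonneg (le_of_lt l.2) hτ]) (negLogLaplace_pos hp0 hp1 l.2).le

theorem kappa_le (hp0 : 0 < p) (hp1 : p < 1) {τ : ℝ} (hτ : 0 ≤ τ) {l : ℝ} (hl : 0 < l) :
    kappa p τ ≤ (2 + l * τ) / negLogLaplace p l :=
  ciInf_le ⟨0, by rintro _ ⟨l, rfl⟩; exact kappa_term_nonneg hp0 hp1 hτ l⟩ (⟨l, hl⟩ : Set.Ioi (0 : ℝ))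

theorem kappa_mul_negLogLaplace_le (hp0 : 0 < p) (hp1 : p < 1) {τ : ℝ} (hτ : 0 ≤ τ) {l : ℝ}
    (hl : 0 < l) : kappa p τ * negLogLaplace p l ≤ 2 + l * τ :=
  (le_div_iff₀ (negLogLaplace_pos hp0 hp1 hl)).1 (kappa_le hp0 hp1 hτ hl)

theorem le_kappa {τ c : ℝ} (h : ∀ l, 0 < l → c ≤ (2 + l * τ) / negLogLaplace p l) :
    c ≤ kappa p τ :=
  le_ciInf fun l => h l l.2

theorem exists_lt_of_kappa_lt {τ c : ℝ} (h : kappa p τ < c) :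
    ∃ l, 0 < l ∧ (2 + l * τ) / negLogLaplace p l < c := by
  obtain ⟨l, hl⟩ := exists_lt_of_ciInf_lt h
  exact ⟨l, l.2, hl⟩

theorem log_one_sub_neg (hp0 : 0 < p) (hp1 : p < 1) : 0 < -Real.log (1 - p) :=
  neg_pos.2 (Real.log_neg (by linarith) (by linarith))

/-- At τ = 0 the infimum is approached as l → ∞, where L tends to its upper bound -log(1-p). -/
theorem kappa_zero (hp0 : 0 < p) (hp1 : p < 1) : kappa p 0 = 2 / -Real.log (1 - p) := by
  have hb := log_one_sub_neg hp0 hp1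
  refine le_antisymm ?_ (le_kappa fun l hl => ?_)
  · refine ge_of_tendsto (tendsto_const_nhds.div (tendsto_negLogLaplace_atTop hp1) hb.ne')
      ((eventually_gt_atTop 0).mono fun l hl => ?_)
    simpa using kappa_le hp0 hp1 le_rfl hl
  · rw [mul_zero, add_zero]
    exact div_le_div_of_nonneg_left (by norm_num) (negLogLaplace_pos hp0 hp1 hl)
      (negLogLaplace_le_neg_log hp0.le hp1 l)

theorem kappa_mono (hp0 : 0 < p) (hp1 : p < 1) {τ τ' : ℝ} (hτ : 0 ≤ τ) (h : τ ≤ τ') :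
    kappa p τ ≤ kappa p τ' :=
  le_kappa fun l hl => (kappa_le hp0 hp1 hτ hl).trans
    (div_le_div_of_nonneg_right (by nlinarith) (negLogLaplace_pos hp0 hp1 hl).le)

theorem div_le_kappa (hp0 : 0 < p) (hp1 : p < 1) {τ : ℝ} (hτ : 0 ≤ τ) :
    τ / p ≤ kappa p τ := by
  refine le_kappa fun l hl => ?_
  have hL := negLogLaplace_pos hp0 hp1 hl
  rw [div_le_div_iff₀ hp0 hL]
  nlinarith [mul_le_mul_of_nonneg_left (negLogLaplace_le_mul hp0.le hp1 l) hτ]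

/-- An infimum of affine functions of τ is concave. -/
theorem kappa_concaveOn (hp0 : 0 < p) (hp1 : p < 1) : ConcaveOn ℝ (Set.Ici 0) (kappa p) := by
  refine ⟨convex_Ici 0, fun x hx y hy a b ha hb hab => le_kappa fun l hl => ?_⟩
  have hL := negLogLaplace_pos hp0 hp1 hl
  rw [le_div_iff₀ hL]
  simp only [smul_eq_mul]
  have h1 := mul_le_mul_of_nonneg_left (kappa_mul_negLogLaplace_le hp0 hp1 hx hl) ha
  have h2 := mul_le_mul_of_nonneg_left (kappa_mul_negLogLaplace_le hp0 hp1 hy hl) hb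
  have h3 : a * (2 + l * x) + b * (2 + l * y) = 2 + l * (a * x + b * y) := by
    linear_combination 2 * hab
  nlinarith

/-- A concave function that is constant between two points cannot increase afterwards, but κ(τ) ≥
τ/p is unbounded. -/
theorem kappa_strictMonoOn (hp0 : 0 < p) (hp1 : p < 1) : StrictMonoOn (kappa p) (Set.Ici 0) := by
  intro x hx y hy hxy
  refine lt_of_le_of_ne (kappa_mono hp0 hp1 hx hxy.le) fun heq => ?_
  set z := max (y + 1) (p * (kappa p y + 1))
  have hyz : y < z := (lt_add_one y).trans_le (le_max_left _ _)
  have hz : kappa p y < kappa p z := by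
    refine lt_of_lt_of_le (lt_add_one _) (le_trans ?_
      (div_le_kappa hp0 hp1 (le_trans hy hyz.le)))
    rw [le_div_iff₀ hp0, mul_comm]
    exact le_max_right _ _
  have := (kappa_concaveOn hp0 hp1).slope_anti_adjacent hx (le_trans hy hyz.le) hxy hyz
  rw [heq, sub_self, zero_div] at this
  exact absurd this (not_le.2 (div_pos (sub_pos.2 hz) (sub_pos.2 hyz)))

theorem kappa_zero_pos (hp0 : 0 < p) (hp1 : p < 1) : 0 < kappa p 0 := by
  rw [kappa_zero hp0 hp1]
  exact div_pos two_pos (log_one_sub_neg hp0 hp1)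

theorem kappa_pos (hp0 : 0 < p) (hp1 : p < 1) {τ : ℝ} (hτ : 0 ≤ τ) : 0 < kappa p τ :=
  (kappa_zero_pos hp0 hp1).trans_le (kappa_mono hp0 hp1 le_rfl hτ)

/-- Concavity gives continuity in the interior only. At 0, a near-optimal affine function bounds κ
from above and monotonicity bounds it from below. -/
theorem kappa_continuousOn (hp0 : 0 < p) (hp1 : p < 1) : ContinuousOn (kappa p) (Set.Ici 0) := by
  intro x hx
  rcases eq_or_lt_of_le (show (0 : ℝ) ≤ x from hx) with rfl | hx0
  · rw [ContinuousWithinAt, Metric.tendsto_nhds]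
    intro ε hε
    obtain ⟨l, hl, hlt⟩ := exists_lt_of_kappa_lt (p := p) (τ := 0) (c := kappa p 0 + ε) (by linarith)
    have h1 : Tendsto (fun τ : ℝ => (2 + l * τ) / negLogLaplace p l) (𝓝[Set.Ici 0] 0)
        (𝓝 ((2 + l * 0) / negLogLaplace p l)) := by
      refine Tendsto.mono_left ?_ nhdsWithin_le_nhds
      exact (Continuous.tendsto (by fun_prop) 0)
    filter_upwards [h1.eventually (gt_mem_nhds hlt), self_mem_nhdsWithin] with τ hτ hτ0
    rw [Real.dist_eq, abs_of_nonneg (sub_nonneg.2 (kappa_mono hp0 hp1 le_rfl hτ0))]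
    linarith [kappa_le hp0 hp1 hτ0 hl]
  · have := (kappa_concaveOn hp0 hp1).continuousOn_interior
    rw [interior_Ici] at this
    exact (this.continuousAt (Ioi_mem_nhds hx0)).continuousWithinAt

/-- For large arguments, `κ τ` is at most a little more than `τ / p`. -/
theorem exists_kappa_le (hp0 : 0 < p) (hp1 : p < 1) {δ : ℝ} (hδ : 0 < δ) :
    ∃ T, 0 < T ∧ ∀ τ, T ≤ τ → kappa p τ ≤ (1 + δ) * (τ / p) := by
  -- One small l serves all large τ: its slope loses a factor 1 + δ/2, and the threshold on τ makes
  -- the constant 2 fit into the rest.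
  obtain ⟨l, hl, hlp⟩ := exists_mul_le_negLogLaplace (p := p) (c := p / (1 + δ / 2))
    (by rw [div_lt_iff₀ (by linarith)]; nlinarith)
  have hL := negLogLaplace_pos hp0 hp1 hl
  refine ⟨4 * (1 + δ / 2) / (l * δ), by positivity, fun τ hτ => ?_⟩
  have hτ0 : 0 ≤ τ := le_trans (by positivity) hτ
  rw [div_le_iff₀ (by positivity)] at hτ
  refine (kappa_le hp0 hp1 hτ0 hl).trans ?_
  rw [div_le_iff₀ hL]
  have h1 : p * l ≤ (1 + δ / 2) * negLogLaplace p l := by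
    rw [div_mul_eq_mul_div, div_le_iff₀ (by linarith)] at hlp
    linarith
  have h2 : (1 + δ) * (τ / p) * negLogLaplace p l * (p * (1 + δ / 2)) =
      (1 + δ) * τ * ((1 + δ / 2) * negLogLaplace p l) := by
    field_simp
  refine le_of_mul_le_mul_right ?_ (show 0 < p * (1 + δ / 2) by positivity)
  rw [h2]
  refine le_trans ?_ (mul_le_mul_of_nonneg_left h1 (by positivity))
  nlinarith

theorem kappa_isEquivalent (hp0 : 0 < p) (hp1 : p < 1) :
    kappa p ~[atTop] fun τ : ℝ => τ / p := by
  rw [IsEquivalent, isLittleO_iff]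
  intro δ hδ
  obtain ⟨T, hT, h⟩ := exists_kappa_le hp0 hp1 hδ
  filter_upwards [eventually_ge_atTop T] with τ hτ
  have hτ0 : 0 ≤ τ := hT.le.trans hτ
  have h1 := div_le_kappa hp0 hp1 hτ0
  rw [Pi.sub_apply, Real.norm_eq_abs, abs_of_nonneg (sub_nonneg.2 h1), Real.norm_eq_abs,
    abs_of_nonneg (div_nonneg hτ0 hp0.le)]
  linarith [h τ hτ]

end Kappa

/-! ### Lower bound for the probability of dependence -/

/-- The tilt that brings the edge density `p` down to just below `x`. -/
theorem exists_tilt {p σ₀ σ x : ℝ} (hp0 : 0 < p) (hp1 : p < 1) (hσ0 : 0 < σ₀) (hσ0p : σ₀ ≤ p)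
    (hσσ0 : σ ≤ σ₀) (htk : 2 * σ₀ < x) :
    ∃ l q, 0 ≤ l ∧ l ≤ Real.log (p / (σ₀ * (1 - p))) ∧
      q = p * Real.exp (-l) / (1 - p + p * Real.exp (-l)) ∧ σ₀ ≤ q ∧ q ≤ p ∧ q + σ ≤ x ∧
      l * q = l * (x - σ) := by
  -- If x - σ ≥ p no tilt is needed: then q = p and l = 0, so that `l * q = l * (x - σ)` holds in
  -- both cases.
  set q := min (x - σ) p
  have hqp : q ≤ p := min_le_right _ _
  have hqσ : σ₀ ≤ q := le_min (by linarith) hσ0p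
  have hq0 : 0 < q := hσ0.trans_le hqσ
  have hq1 : 0 < 1 - q := by linarith
  have hp1' : 0 < 1 - p := by linarith
  set l := Real.log (p * (1 - q) / (q * (1 - p)))
  have hl : 0 ≤ l := Real.log_nonneg (by
    rw [le_div_iff₀ (by positivity)]
    nlinarith)
  have hlΛ : l ≤ Real.log (p / (σ₀ * (1 - p))) := by
    refine Real.log_le_log (by positivity) ?_
    rw [div_le_div_iff₀ (by positivity) (by positivity)]
    have : σ₀ * (1 - q) ≤ q := by nlinarith
    nlinarith [mul_le_mul_of_nonneg_left this (show 0 ≤ p * (1 - p) by positivity)]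
  have hexp : Real.exp (-l) = q * (1 - p) / (p * (1 - q)) := by
    rw [Real.exp_neg, Real.exp_log (by positivity), inv_div]
  have hq : q = p * Real.exp (-l) / (1 - p + p * Real.exp (-l)) := by
    rw [hexp]
    field_simp
    ring
  have hlq : l * q = l * (x - σ) := by
    rcases le_total (x - σ) p with h | h
    · simp only [q, min_eq_left h]
    · have : l = 0 := by
        simp only [l, q, min_eq_right h]
        rw [div_self (by positivity), Real.log_one]
      rw [this, zero_mul, zero_mul]
  exact ⟨l, q, hl, hlΛ, hq, hqσ, hqp, by linarith [min_le_left (x - σ) p], hlq⟩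

theorem exists_bernoulliExp_dependentInd_ge {p η : ℝ} (hp0 : 0 < p) (hp1 : p < 1) (hη : 0 < η) :
    ∃ k₀ : ℕ, ∀ (V : Type) [Fintype V] [DecidableEq V] (S : Finset V) (t : ℝ), k₀ ≤ S.card →
      0 ≤ t → ∃ l, 0 ≤ l ∧
        Real.exp (-(S.card / 2 * (S.card * negLogLaplace p l - l * t)) - η * S.card ^ 2) ≤
          bernoulliExp (fun _ => p) (dependentInd t S) := by
  have hb := log_one_sub_neg hp0 hp1
  obtain ⟨l0, hl0, hl0'⟩ := (((tendsto_negLogLaplace_atTop hp1).eventually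
    (lt_mem_nhds (show -Real.log (1 - p) - η < -Real.log (1 - p) by linarith))).and
      (eventually_ge_atTop 0)).exists
  -- For t ≤ 2σ₀k the empty graph is likely enough, compared at the large tilt `l0`. For larger t
  -- the tilt is at most Λ, so the margin σ and the threshold `k₀` can be fixed before t.
  set σ0 := min p (η / (2 * (l0 + 1)))
  have hσ0 : 0 < σ0 := lt_min hp0 (by positivity)
  have hσ0p : σ0 ≤ p := min_le_left _ _
  have hσ0l : l0 * σ0 ≤ η / 2 := by
    have h1 : σ0 ≤ η / (2 * (l0 + 1)) := min_le_right _ _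
    rw [le_div_iff₀ (by positivity)] at h1
    nlinarith
  set Λ := Real.log (p / (σ0 * (1 - p)))
  have hΛ : 0 ≤ Λ := Real.log_nonneg (by
    rw [le_div_iff₀ (by nlinarith)]
    nlinarith)
  set σ := min σ0 (η / (2 * (Λ + 1)))
  have hσ : 0 < σ := lt_min hσ0 (by positivity)
  have hσσ0 : σ ≤ σ0 := min_le_left _ _
  have hσΛ : Λ * σ ≤ η / 2 := by
    have h1 : σ ≤ η / (2 * (Λ + 1)) := min_le_right _ _
    rw [le_div_iff₀ (by positivity)] at h1
    nlinarith
  have hlim : Tendsto (fun k : ℕ => ((k : ℝ) + 1) * Real.exp (-(σ ^ 2 / 4 * k))) atTop (𝓝 0) := by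
    have h1 := (Real.tendsto_pow_mul_exp_neg_atTop_nhds_zero 1).comp
      ((tendsto_natCast_atTop_atTop (R := ℝ)).const_mul_atTop (show 0 < σ ^ 2 / 4 by positivity))
    have h2 := (Real.tendsto_exp_neg_atTop_nhds_zero).comp
      ((tendsto_natCast_atTop_atTop (R := ℝ)).const_mul_atTop (show 0 < σ ^ 2 / 4 by positivity))
    have h3 := (h1.const_mul (σ ^ 2 / 4)⁻¹).add h2
    rw [mul_zero, add_zero] at h3
    refine h3.congr fun k => ?_
    simp only [Function.comp_apply, pow_one]
    field_simp
  obtain ⟨k₀, hk₀⟩ := ((hlim.eventually (ge_mem_nhds (show (0 : ℝ) < 1 / 2 by norm_num))).and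
    (((tendsto_natCast_atTop_atTop (R := ℝ)).eventually_ge_atTop (2 * Real.log 2 / η)).and
      (eventually_ge_atTop 3))).exists_forall_of_atTop
  refine ⟨k₀, fun V _ _ S t hS ht => ?_⟩
  obtain ⟨hk1, hk2, hk3⟩ := hk₀ _ hS
  set k := S.card
  have hk3' : (3 : ℝ) ≤ k := by exact_mod_cast hk3
  have hk0 : (0 : ℝ) < k := by linarith
  have hlog2 : Real.log 2 ≤ η / 2 * k ^ 2 := by
    rw [div_le_iff₀ hη] at hk2
    nlinarith [mul_pos hη hk0]
  have hF := two_mul_card_cliqueEdges S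
  have hF0 : (0 : ℝ) ≤ (cliqueEdges S).card := Nat.cast_nonneg _
  rcases le_or_gt t (2 * σ0 * k) with hcase | hcase
  · refine ⟨l0, hl0', le_trans ?_ (pow_le_bernoulliExp_dependentInd hp0.le hp1 ht S)⟩
    rw [← Real.exp_log (show 0 < 1 - p by linarith), ← Real.exp_nat_mul, Real.exp_le_exp]
    have a1 : l0 * t ≤ η * k := by
      nlinarith [mul_le_mul_of_nonneg_left hcase hl0', mul_le_mul_of_nonneg_right hσ0l hk0.le]
    have a2 : (k : ℝ) * (-Real.log (1 - p) - η) ≤ k * negLogLaplace p l0 :=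
      mul_le_mul_of_nonneg_left hl0.le hk0.le
    have a3 : ((cliqueEdges S).card : ℝ) ≤ k ^ 2 / 2 := by nlinarith
    nlinarith [mul_le_mul_of_nonneg_right a3 hb.le]
  · have htk : 2 * σ0 < t / k := (lt_div_iff₀ hk0).2 hcase
    obtain ⟨l, q, hl, hlΛ, hq, hqσ, hqp, hqt, hlq⟩ := exists_tilt hp0 hp1 hσ0 hσ0p hσσ0 htk
    have hLq : l * q ≤ negLogLaplace p l := by
      have := mul_tilt_le_negLogLaplace hp0 hp1 l
      rwa [← hq] at this
    refine ⟨l, hl, le_trans ?_ (bernoulliExp_dependentInd_ge_of_tilt hp0 hp1 hl hq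
      (hσ0.le.trans hqσ) (by linarith) hσ.le (by linarith) S ?_ hk3 hk1)⟩
    · rw [show (1 / 2 : ℝ) = Real.exp (-Real.log 2) by
        rw [Real.exp_neg, Real.exp_log two_pos, one_div], ← Real.exp_add, Real.exp_le_exp]
      have a1 : ((cliqueEdges S).card : ℝ) * (negLogLaplace p l - l * (q - σ)) ≤
          k ^ 2 / 2 * (negLogLaplace p l - l * (q - σ)) :=
        mul_le_mul_of_nonneg_right (by nlinarith) (by linarith [mul_nonneg hl hσ.le])
      have a2 : (k : ℝ) ^ 2 / 2 * (negLogLaplace p l - l * (q - σ)) =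
          k / 2 * (k * negLogLaplace p l - l * t) + k ^ 2 * (l * σ) := by
        rw [mul_sub l, hlq]
        field_simp
        ring
      have a3 : l * σ ≤ η / 2 := (mul_le_mul_of_nonneg_right hlΛ hσ.le).trans hσΛ
      have a4 := mul_le_mul_of_nonneg_left a3 (sq_nonneg (k : ℝ))
      linarith
    · exact (le_div_iff₀ hk0).1 hqt

/-! ### Every large set contains a large dependent set -/

section Counting

/-- The ratio of the binomials is at most (k/m)^l, because (k-i)/(m-i) ≤ k/m factor by factor. -/
theorem choose_mul_pow_le {k m : ℕ} (hkm : k ≤ m) (l : ℕ) :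
    k.choose l * m ^ l ≤ k ^ l * m.choose l := by
  have h : k.descFactorial l * m ^ l ≤ k ^ l * m.descFactorial l := by
    induction l with
    | zero => simp
    | succ l ih =>
      rw [Nat.descFactorial_succ, Nat.descFactorial_succ, pow_succ, pow_succ]
      have h1 : (k - l) * m ≤ k * (m - l) := by
        rw [Nat.sub_mul, Nat.mul_sub]
        have := Nat.mul_le_mul_left l hkm
        rw [mul_comm k l]
        omega
      calc (k - l) * k.descFactorial l * (m ^ l * m)
          = ((k - l) * m) * (k.descFactorial l * m ^ l) := by ring
        _ ≤ (k * (m - l)) * (k ^ l * m.descFactorial l) := Nat.mul_le_mul h1 ih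
        _ = _ := by ring
  rw [Nat.descFactorial_eq_factorial_mul_choose, Nat.descFactorial_eq_factorial_mul_choose] at h
  have : l.factorial * (k.choose l * m ^ l) ≤ l.factorial * (k ^ l * m.choose l) := by
    calc _ = l.factorial * k.choose l * m ^ l := by ring
      _ ≤ _ := h
      _ = _ := by ring
  exact Nat.le_of_mul_le_mul_left this (Nat.factorial_pos l)

variable {V : Type*} [DecidableEq V]

/-- The number of `k`-subsets of `W` that meet `S` in exactly `l` elements. -/
theorem card_filter_card_inter_le {S W : Finset V} {k : ℕ} (hS : S.card = k)
    (hkm : k ≤ W.card) (hSW : S ⊆ W) {l : ℕ} (hl : l ≤ k) :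
    (((W.powersetCard k).filter fun T => (S ∩ T).card = l).card : ℝ) ≤
      (W.card.choose k : ℝ) * ((k : ℝ) ^ 2 / W.card) ^ l := by
  set m := W.card
  have h1 : ((W.powersetCard k).filter fun T => (S ∩ T).card = l).card ≤
      k.choose l * (m - l).choose (k - l) := by
    have hsub : (W.powersetCard k).filter (fun T => (S ∩ T).card = l) ⊆
        (S.powersetCard l).biUnion fun O => ((W \ O).powersetCard (k - l)).image (O ∪ ·) := by
      intro T hT
      rw [Finset.mem_filter, Finset.mem_powersetCard] at hT
      obtain ⟨⟨hTW, hTk⟩, hTl⟩ := hT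
      rw [Finset.mem_biUnion]
      refine ⟨S ∩ T, Finset.mem_powersetCard.2 ⟨Finset.inter_subset_left, hTl⟩,
        Finset.mem_image.2 ⟨T \ (S ∩ T), Finset.mem_powersetCard.2
          ⟨Finset.sdiff_subset_sdiff hTW le_rfl, ?_⟩, ?_⟩⟩
      · rw [Finset.card_sdiff_of_subset Finset.inter_subset_right, hTk, hTl]
      · exact Finset.union_sdiff_of_subset Finset.inter_subset_right
    refine (Finset.card_le_card hsub).trans (Finset.card_biUnion_le.trans ?_)
    have : ∀ O ∈ S.powersetCard l, (((W \ O).powersetCard (k - l)).image (O ∪ ·)).card ≤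
        (m - l).choose (k - l) := fun O hO => by
      rw [Finset.mem_powersetCard] at hO
      refine Finset.card_image_le.trans (le_of_eq ?_)
      rw [Finset.card_powersetCard, Finset.card_sdiff_of_subset (hO.1.trans hSW), hO.2]
    refine (Finset.sum_le_card_nsmul _ _ _ this).trans (le_of_eq ?_)
    rw [Finset.card_powersetCard, hS, smul_eq_mul]
  rcases Nat.eq_zero_or_pos m with hm | hm
  · have hl0 : l = 0 := by omega
    have hk0 : k = 0 := by omega
    subst hl0
    rw [pow_zero, mul_one]
    refine le_trans (Nat.cast_le.2 h1) ?_
    simp [hk0]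
  have h2 := Nat.choose_mul (n := m) hl
  have h3 := choose_mul_pow_le hkm l
  have h4 : k.choose l ≤ k ^ l := Nat.choose_le_pow k l
  have hpos : 0 < m.choose l := Nat.choose_pos (hl.trans hkm)
  -- The proportion of such sets is C(k,l)²/C(m,l); one factor C(k,l) is bounded by k^l, the other
  -- over C(m,l) by (k/m)^l.
  have h5 : (k.choose l * (m - l).choose (k - l)) * m ^ l ≤ m.choose k * (k ^ 2) ^ l := by
    refine Nat.le_of_mul_le_mul_left ?_ hpos
    calc m.choose l * (k.choose l * (m - l).choose (k - l) * m ^ l)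
        = (m.choose l * (m - l).choose (k - l)) * (k.choose l * m ^ l) := by ring
      _ = (m.choose k * k.choose l) * (k.choose l * m ^ l) := by rw [h2]
      _ ≤ (m.choose k * k ^ l) * (k ^ l * m.choose l) :=
          Nat.mul_le_mul (Nat.mul_le_mul_left _ h4) h3
      _ = _ := by rw [← pow_mul, two_mul, pow_add]; ring
  rw [div_pow, ← mul_div_assoc, le_div_iff₀ (by positivity)]
  exact_mod_cast (Nat.mul_le_mul_right _ h1).trans h5

end Counting

/-! ### Janson's inequality for the dependent k-subsets of a set -/

section Janson

variable {V : Type*} [Fintype V] [DecidableEq V]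

/-- The second-moment sum is controlled by the correlations of overlapping pairs. -/
theorem bernoulliExp_prod_one_sub_dependentInd_le {p : ℝ} (hp0 : 0 ≤ p) (hp1 : p < 1) {t : ℝ}
    (ht : 0 ≤ t) {k : ℕ} (hk : 2 ≤ k) {W : Finset V} (hkW : k ≤ W.card) {w : ℕ → ℝ}
    (hw : ∀ S T : Finset V, S.card = k → T.card = k → 2 ≤ (S ∩ T).card →
      bernoulliExp (fun _ => p) (fun ω => dependentInd t S ω * dependentInd t T ω) ≤
        bernoulliExp (fun _ => p) (dependentInd t S) *
          (bernoulliExp (fun _ => p) (dependentInd t T) * w (S ∩ T).card))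
    (hw0 : ∀ l, 0 ≤ w l) {θ : ℝ} (hθ0 : 0 < θ)
    (hθ : ∑ l ∈ Finset.Icc 2 k, ((k : ℝ) ^ 2 / W.card) ^ l * w l ≤ θ) :
    bernoulliExp (fun _ => p) (fun ω => ∏ S ∈ W.powersetCard k, (1 - dependentInd t S ω)) ≤
      Real.exp (-(1 / (4 * θ))) := by
  have h0 : ∀ e : Sym2 V, 0 ≤ (fun _ => p) e := fun _ => hp0
  have h1 : ∀ e : Sym2 V, (fun _ => p) e ≤ 1 := fun _ => hp1.le
  obtain ⟨S₀, hS₀W, hS₀⟩ := Finset.exists_subset_card_eq hkW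
  set P := bernoulliExp (fun _ => p) (dependentInd t S₀)
  have hP : ∀ S : Finset V, S.card = k → bernoulliExp (fun _ => p) (dependentInd t S) = P :=
    fun S hS => bernoulliExp_dependentInd_eq_of_card_eq p t (hS.trans hS₀.symm)
  have hPpos : 0 < P :=
    (pow_pos (by linarith) _).trans_le (pow_le_bernoulliExp_dependentInd hp0 hp1 ht S₀)
  set I := W.powersetCard k
  have hIk : ∀ S ∈ I, S.card = k := fun S hS => (Finset.mem_powersetCard.1 hS).2
  have hμ : (W.card.choose k : ℝ) * P = ∑ S ∈ I, bernoulliExp (fun _ => p) (dependentInd t S) := by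
    rw [Finset.sum_congr rfl fun S hS => hP S (hIk S hS), Finset.sum_const, nsmul_eq_mul,
      Finset.card_powersetCard]
  set μ := (W.card.choose k : ℝ) * P
  have hμpos : 0 < μ := mul_pos (Nat.cast_pos.2 (Nat.choose_pos hkW)) hPpos
  have hd0 : ∀ S T : Finset V, 0 ≤
      bernoulliExp (fun _ => p) (fun ω => dependentInd t S ω * dependentInd t T ω) := fun S T =>
    bernoulliExp_nonneg h0 h1 fun ω =>
      mul_nonneg (dependentInd_nonneg t S ω) (dependentInd_nonneg t T ω)
  have hrow : ∀ S ∈ I, ∑ T ∈ I with ¬ Disjoint (cliqueEdges S) (cliqueEdges T),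
      bernoulliExp (fun _ => p) (fun ω => dependentInd t S ω * dependentInd t T ω) ≤
        P * (μ * θ) := fun S hS => by
    have hSk := hIk S hS
    have hinter : ∀ T ∈ I.filter fun T => ¬ Disjoint (cliqueEdges S) (cliqueEdges T),
        2 ≤ (S ∩ T).card :=
      fun T hT => by
        by_contra hlt
        exact (Finset.mem_filter.1 hT).2 (disjoint_cliqueEdges_of_card_lt (not_le.1 hlt))
    calc _ ≤ ∑ T ∈ I with ¬ Disjoint (cliqueEdges S) (cliqueEdges T),
          P * (P * w (S ∩ T).card) := by
          refine Finset.sum_le_sum fun T hT => ?_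
          have hTk := hIk T (Finset.mem_filter.1 hT).1
          have := hw S T hSk hTk (hinter T hT)
          rwa [hP S hSk, hP T hTk] at this
      _ = ∑ l ∈ Finset.Icc 2 k, ∑ T ∈ I.filter
            (fun T => ¬ Disjoint (cliqueEdges S) (cliqueEdges T)) with (S ∩ T).card = l,
          P * (P * w (S ∩ T).card) := by
          refine (Finset.sum_fiberwise_of_maps_to (fun T hT => ?_) _).symm
          rw [Finset.mem_Icc]
          exact ⟨hinter T hT, hSk ▸ Finset.card_le_card Finset.inter_subset_left⟩
      _ ≤ ∑ l ∈ Finset.Icc 2 k,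
            (W.card.choose k : ℝ) * ((k : ℝ) ^ 2 / W.card) ^ l * (P * (P * w l)) := by
          refine Finset.sum_le_sum fun l hl => ?_
          have hPw : 0 ≤ P * (P * w l) := mul_nonneg hPpos.le (mul_nonneg hPpos.le (hw0 l))
          rw [Finset.sum_congr rfl (g := fun _ => P * (P * w l))
            fun T hT => by rw [(Finset.mem_filter.1 hT).2], Finset.sum_const, nsmul_eq_mul]
          refine mul_le_mul_of_nonneg_right (le_trans ?_ (card_filter_card_inter_le hSk hkW
            (Finset.mem_powersetCard.1 hS).1 (Finset.mem_Icc.1 hl).2)) hPw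
          exact Nat.cast_le.2 (Finset.card_le_card
            (Finset.filter_subset_filter _ (Finset.filter_subset _ _)))
      _ = P * (μ * ∑ l ∈ Finset.Icc 2 k, ((k : ℝ) ^ 2 / W.card) ^ l * w l) := by
          rw [Finset.mul_sum, Finset.mul_sum]
          exact Finset.sum_congr rfl fun l _ => by simp only [μ]; ring
      _ ≤ _ := mul_le_mul_of_nonneg_left (mul_le_mul_of_nonneg_left hθ hμpos.le) hPpos.le
  have hΔ : ∑ S ∈ I, ∑ T ∈ I with ¬ Disjoint (cliqueEdges S) (cliqueEdges T),
      bernoulliExp (fun _ => p) (fun ω => dependentInd t S ω * dependentInd t T ω) ≤ μ ^ 2 * θ := by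
    refine (Finset.sum_le_card_nsmul _ _ _ hrow).trans (le_of_eq ?_)
    rw [nsmul_eq_mul, Finset.card_powersetCard]
    simp only [μ]
    ring
  -- The pair sum contains the diagonal, since for k ≥ 2 a set shares an edge with itself, and an
  -- indicator equals its square.
  have hμΔ : μ ≤ μ ^ 2 * θ := by
    refine le_trans ?_ hΔ
    rw [hμ]
    refine Finset.sum_le_sum fun S hS => ?_
    have hSmem : S ∈ I.filter fun T => ¬ Disjoint (cliqueEdges S) (cliqueEdges T) := by
      refine Finset.mem_filter.2 ⟨hS, fun h => ?_⟩
      rw [disjoint_self, Finset.bot_eq_empty, ← Finset.card_eq_zero, card_cliqueEdges, hIk S hS] at h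
      exact (Nat.choose_pos hk).ne' h
    refine le_trans (le_of_eq ?_) (Finset.single_le_sum (fun T _ => hd0 S T) hSmem)
    congr 1
    ext ω
    unfold dependentInd
    split_ifs <;> simp
  have key := bernoulliExp_prod_one_sub_le_exp_neg_sq_div h0 h1 I (dependentInd t) cliqueEdges
    (dependentInd_nonneg t) (dependentInd_le_one t) (dependentInd_antitone t)
    (dependentInd_dependsOn t) hμpos hμ hμΔ hΔ
  refine key.trans (le_of_eq ?_)
  congr 2
  field_simp

end Janson

/-! ### Overlap estimates and the probability of having no large dependent subset -/

section LargeDependent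

theorem tendsto_log_natCast : Tendsto (fun n : ℕ => Real.log n) atTop atTop :=
  Real.tendsto_log_atTop.comp tendsto_natCast_atTop_atTop

theorem eventually_mul_sq_le_exp (b : ℝ) {a : ℝ} (ha : 0 < a) :
    ∀ᶠ x : ℝ in atTop, b * x ^ 2 ≤ Real.exp (a * x) := by
  filter_upwards [((isLittleO_pow_exp_pos_mul_atTop 2 ha).const_mul_left b).bound
    (c := 1) one_pos] with x hx
  rw [one_mul, Real.norm_eq_abs, Real.norm_eq_abs, Real.abs_exp] at hx
  exact (le_abs_self _).trans hx

/-- The exponent bounding the contribution of pairs with overlap `l`. -/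
theorem overlap_exponent_le {ε x B η C γ k l y : ℝ} (hε : 0 < ε) (hε4 : ε ≤ 1 / 4) (hx : 0 < x)
    (hη0 : 0 ≤ η) (hC : 0 < C) (hγB : γ * B ≤ 1 / 4) (hη : η = γ * ε / (8 * C ^ 2))
    (hk0 : 0 ≤ k) (hkC : k ≤ C * x) (hkB : k * B / 2 ≤ η * k ^ 2) (hxγ : 6 ≤ γ * ε * x)
    (hl : 2 ≤ l) (hB : 0 ≤ B) (hy : y ≤ ε / 4 * x - (1 - ε / 4) * x) :
    l * y + min (l ^ 2 / 2 * B) (l * ((1 - ε) * x) + k * B / 2 + η * k ^ 2) ≤ -(3 / 2 * x) := by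
  have hly : l * y ≤ l * (ε / 4 * x - (1 - ε / 4) * x) :=
    mul_le_mul_of_nonneg_left hy (by linarith)
  -- Large overlap: y + (1-ε)x ≤ -εx/2, so the total is at most -γεx²/4. Small overlap: lB/2 ≤ x/8
  -- and y ≤ -7x/8, so the total is at most -3lx/4 with l ≥ 2.
  rcases le_total (γ * x) l with h | h
  · refine (add_le_add hly (min_le_right _ _)).trans ?_
    have h1 : η * k ^ 2 ≤ γ * ε / 8 * x ^ 2 := by
      calc η * k ^ 2 ≤ η * (C * x) ^ 2 := by gcongr
        _ = _ := by rw [hη]; field_simp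
    have h2 : γ * x * (ε / 2 * x) ≤ l * (ε / 2 * x) :=
      mul_le_mul_of_nonneg_right h (by positivity)
    nlinarith
  · refine (add_le_add hly (min_le_left _ _)).trans ?_
    have h1 : l * B ≤ x / 4 := by
      nlinarith [mul_le_mul_of_nonneg_right h hB, mul_le_mul_of_nonneg_left hγB hx.le]
    have h2 : l * (l * B) ≤ l * (x / 4) := mul_le_mul_of_nonneg_left h1 (by linarith)
    have h3 : 0 ≤ (l - 2) * x := mul_nonneg (by linarith) hx.le
    nlinarith [mul_nonneg (show 0 ≤ l by linarith) (mul_nonneg (sub_nonneg.2 hε4) hx.le)]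

/-- The correlation of two `k`-sets of overlap `l`, on the scale where `k ≤ (1 - ε) κ ln n`. -/
theorem bernoulliExp_dependentInd_mul_le_min {V : Type*} [Fintype V] [DecidableEq V] {p : ℝ}
    (hp0 : 0 ≤ p) (hp1 : p < 1) {t l η Z : ℝ} (hl : 0 ≤ l) {k : ℕ}
    (hZ : k * negLogLaplace p l - l * t ≤ 2 * Z)
    {S T : Finset V} (hT : T.card = k)
    (hP : Real.exp (-(k / 2 * (k * negLogLaplace p l - l * t)) - η * k ^ 2) ≤
      bernoulliExp (fun _ => p) (dependentInd t T)) :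
    bernoulliExp (fun _ => p) (fun ω => dependentInd t S ω * dependentInd t T ω) ≤
      bernoulliExp (fun _ => p) (dependentInd t S) *
        (bernoulliExp (fun _ => p) (dependentInd t T) *
          Real.exp (min (((S ∩ T).card : ℝ) ^ 2 / 2 * -Real.log (1 - p))
            ((S ∩ T).card * Z + k * -Real.log (1 - p) / 2 + η * k ^ 2))) := by
  have hPS := bernoulliExp_nonneg (fun _ => hp0) (fun _ => hp1.le) (dependentInd_nonneg t S)
  have hPT := bernoulliExp_nonneg (fun _ => hp0) (fun _ => hp1.le) (dependentInd_nonneg t T)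
  have hq : 0 < 1 - p := by linarith
  have hB : 0 ≤ -Real.log (1 - p) := neg_nonneg.2 (Real.log_nonpos hq.le (by linarith))
  set i := (S ∩ T).card
  rcases min_choice ((i : ℝ) ^ 2 / 2 * -Real.log (1 - p))
    (i * Z + k * -Real.log (1 - p) / 2 + η * k ^ 2) with h | h
  · rw [h]
    refine (bernoulliExp_dependentInd_mul_le_div hp0 hp1 t S T).trans
      (mul_le_mul_of_nonneg_left ?_ hPS)
    rw [div_eq_mul_inv]
    refine mul_le_mul_of_nonneg_left ?_ hPT
    rw [← Real.exp_log hq, ← Real.exp_nat_mul, ← Real.exp_neg, Real.exp_le_exp, Real.log_exp]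
    have := two_mul_card_cliqueEdges (S ∩ T)
    have hi : (0 : ℝ) ≤ i := Nat.cast_nonneg _
    have h2 : ((cliqueEdges (S ∩ T)).card : ℝ) ≤ (i : ℝ) ^ 2 / 2 := by nlinarith
    nlinarith [mul_le_mul_of_nonneg_right h2 hB]
  -- The lower bound `hP` almost cancels the exponent for `T \ S`. What remains is the share `i * Z`
  -- of the overlap, the rounding k-1 against k, which costs at most kL/2, and the error ηk².
  · rw [h]
    refine (bernoulliExp_dependentInd_mul_le_exp hp0 hp1 t hl S T).trans
      (mul_le_mul_of_nonneg_left ?_ hPS)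
    refine le_trans ?_ (mul_le_mul_of_nonneg_right hP (Real.exp_pos _).le)
    rw [← Real.exp_add, Real.exp_le_exp, hT]
    have hcard : ((T \ S).card : ℝ) = k - i := by
      have := Finset.card_sdiff_add_card_inter T S
      rw [Finset.inter_comm, hT] at this
      have h3 : ((T \ S).card : ℝ) + i = k := by exact_mod_cast this
      linarith
    rw [hcard]
    have hL := negLogLaplace_le_neg_log hp0 hp1 l
    have hL0 := negLogLaplace_nonneg hp0 hp1 hl
    have hi : (0 : ℝ) ≤ i := Nat.cast_nonneg _
    have hk : (0 : ℝ) ≤ k := Nat.cast_nonneg _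
    have a1 := mul_le_mul_of_nonneg_left hZ hi
    have a2 := mul_le_mul_of_nonneg_left hL hk
    have a3 := mul_nonneg hi hL0
    nlinarith

/-- Sets a little smaller than `κ ln n` have subcritical exponent for every tilt. -/
theorem mul_negLogLaplace_sub_le {p ε x t k : ℝ} (hp0 : 0 < p) (hp1 : p < 1) (hε : 0 ≤ ε)
    (hε1 : ε ≤ 1) (hx : 0 < x) (ht : 0 ≤ t) (hk : k ≤ (1 - ε) * (kappa p (t / x) * x))
    {l : ℝ} (hl : 0 ≤ l) : k * negLogLaplace p l - l * t ≤ 2 * ((1 - ε) * x) := by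
  have hε' : 0 ≤ (1 - ε) * x := mul_nonneg (by linarith) hx.le
  rcases eq_or_lt_of_le hl with rfl | hl
  · rw [negLogLaplace_zero]
    linarith
  · have h1 := kappa_mul_negLogLaplace_le hp0 hp1 (div_nonneg ht hx.le) hl
    have h2 := mul_le_mul_of_nonneg_right hk (negLogLaplace_nonneg hp0.le hp1 hl.le)
    have h3 := mul_le_mul_of_nonneg_left h1 hε'
    have h4 : (1 - ε) * x * (2 + l * (t / x)) = 2 * ((1 - ε) * x) + (l * t - ε * (l * t)) := by
      field_simp
    have h5 := mul_nonneg hε (mul_nonneg hl.le ht)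
    linarith

/-- A vertex set of size at least `n ^ (1 - ε / 4)` fails to contain a dependent set of size almost
`κ ln n` with exponentially small probability. -/
theorem eventually_forall_bernoulliExp_prod_le {p ε T c : ℝ} (hp0 : 0 < p) (hp1 : p < 1)
    (hε : 0 < ε) (hε4 : ε ≤ 1 / 4) (hT : 0 ≤ T) (hc : 0 < c) :
    ∀ᶠ n : ℕ in atTop, ∀ t : ℝ, 0 ≤ t → t ≤ T * Real.log n → ∀ k : ℕ, c * Real.log n ≤ k →
      (k : ℝ) ≤ (1 - ε) * (kappa p (t / Real.log n) * Real.log n) →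
      ∀ W : Finset (Fin n), Real.exp ((1 - ε / 4) * Real.log n) ≤ W.card →
        bernoulliExp (fun _ => p)
          (fun ω => ∏ S ∈ W.powersetCard k, (1 - dependentInd t S ω)) ≤ Real.exp (-(2 * n)) := by
  set B := -Real.log (1 - p)
  have hB : 0 < B := log_one_sub_neg hp0 hp1
  set C := kappa p T
  have hC : 0 < C := kappa_pos hp0 hp1 hT
  -- Overlaps below γ ln n are charged for being empty, larger ones by exponential moments; η keeps
  -- the error ηk² below the gain of order γε(ln n)² from a large overlap.
  set γ := 1 / (4 * B)
  have hγ : 0 < γ := by positivity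
  have hγB : γ * B ≤ 1 / 4 := by simp only [γ]; field_simp; norm_num
  set η := γ * ε / (8 * C ^ 2) with hηdef
  have hη : 0 < η := by positivity
  obtain ⟨k₀, hk₀⟩ := exists_bernoulliExp_dependentInd_ge hp0 hp1 hη
  filter_upwards [tendsto_log_natCast.eventually_ge_atTop 1,
    tendsto_log_natCast.eventually_ge_atTop (k₀ / c),
    tendsto_log_natCast.eventually_ge_atTop (2 / c),
    tendsto_log_natCast.eventually_ge_atTop (B / (2 * η) / c),
    tendsto_log_natCast.eventually_ge_atTop (6 / (γ * ε)),
    tendsto_log_natCast.eventually (eventually_mul_sq_le_exp (C ^ 2)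
      (show 0 < ε / 4 by positivity)),
    tendsto_log_natCast.eventually (eventually_mul_sq_le_exp (8 * C)
      (show (0 : ℝ) < 1 / 2 by norm_num)),
    tendsto_log_natCast.eventually (eventually_mul_sq_le_exp C
      (show 0 < 1 - ε / 4 by linarith)), eventually_gt_atTop 0]
    with n hx1 hxk₀ hx2 hxB hxγ hxε hxθ hxW hn t ht htT k hck hkκ W hW
  set x := Real.log n
  have hx0 : 0 < x := by linarith
  have hn0 : (0 : ℝ) < n := Nat.cast_pos.2 hn
  have hnx : Real.exp x = n := Real.exp_log hn0
  rw [div_le_iff₀ hc] at hxk₀ hx2 hxB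
  rw [div_le_iff₀ (by positivity)] at hxγ
  have hτ : 0 ≤ t / x := div_nonneg ht hx0.le
  have hκC : kappa p (t / x) ≤ C := kappa_mono hp0 hp1 hτ ((div_le_iff₀ hx0).2 htT)
  have hκ0 := kappa_pos hp0 hp1 hτ
  have hkC : (k : ℝ) ≤ C * x := hkκ.trans (by
    have := mul_le_mul_of_nonneg_right hκC hx0.le
    nlinarith [mul_pos hκ0 hx0])
  have hk2 : 2 ≤ k := by
    have : (2 : ℝ) ≤ k := by linarith
    exact_mod_cast this
  have hkk₀ : k₀ ≤ k := by
    have : (k₀ : ℝ) ≤ k := by linarith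
    exact_mod_cast this
  have hk0 : (0 : ℝ) < k := by positivity
  have hkx : (k : ℝ) ≤ C * x ^ 2 := hkC.trans (by
    rw [pow_two]
    exact mul_le_mul_of_nonneg_left (le_mul_of_one_le_left hx0.le hx1) hC.le)
  have hkW : k ≤ W.card := by
    have : (k : ℝ) ≤ W.card := by
      exact (hkx.trans hxW).trans hW
    exact_mod_cast this
  have hW0 : (0 : ℝ) < W.card := (Real.exp_pos _).trans_le hW
  have hkB : k * B / 2 ≤ η * k ^ 2 := by
    have : B / (2 * η) ≤ k := by linarith
    rw [div_le_iff₀ (by positivity)] at this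
    nlinarith
  have hZ : ∀ l, 0 ≤ l → k * negLogLaplace p l - l * t ≤ 2 * ((1 - ε) * x) := fun l hl =>
    mul_negLogLaplace_sub_le hp0 hp1 hε.le (by linarith) hx0 ht hkκ hl
  set w : ℕ → ℝ := fun l => Real.exp (min ((l : ℝ) ^ 2 / 2 * B)
    (l * ((1 - ε) * x) + k * B / 2 + η * k ^ 2))
  -- At most k overlap sizes contribute n^(-3/2) each, and θ = k n^(-3/2) gives 1/(4θ) ≥ 2n because
  -- k is of order ln n.
  have key := bernoulliExp_prod_one_sub_dependentInd_le hp0.le hp1 ht hk2 hkW (w := w)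
    (θ := k * Real.exp (-(3 / 2 * x))) (fun S T' _ hT' _ => by
      obtain ⟨l, hl, hP⟩ := hk₀ (Fin n) T' t (hT' ▸ hkk₀) ht
      rw [hT'] at hP
      exact bernoulliExp_dependentInd_mul_le_min hp0.le hp1 hl (hZ l hl) hT' hP)
    (fun l => (Real.exp_pos _).le) (by positivity) ?_
  · refine key.trans (Real.exp_le_exp.2 (neg_le_neg ?_))
    rw [le_div_iff₀ (by positivity)]
    have h1 : Real.exp (-(3 / 2 * x)) * n = Real.exp (-(1 / 2 * x)) := by
      rw [← hnx, ← Real.exp_add]; congr 1; ring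
    calc 2 * (n : ℝ) * (4 * (k * Real.exp (-(3 / 2 * x))))
        = 8 * k * (Real.exp (-(3 / 2 * x)) * n) := by ring
      _ = 8 * k * Real.exp (-(1 / 2 * x)) := by rw [h1]
      _ ≤ Real.exp (1 / 2 * x) * Real.exp (-(1 / 2 * x)) := by
          refine mul_le_mul_of_nonneg_right (le_trans ?_ hxθ) (Real.exp_pos _).le
          linarith
      _ = 1 := by rw [← Real.exp_add]; simp
  · have hterm : ∀ l ∈ Finset.Icc 2 k,
        ((k : ℝ) ^ 2 / W.card) ^ l * w l ≤ Real.exp (-(3 / 2 * x)) := fun l hl => by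
      have hl2 : (2 : ℝ) ≤ l := by exact_mod_cast (Finset.mem_Icc.1 hl).1
      have hb : (0 : ℝ) < (k : ℝ) ^ 2 / W.card := by positivity
      rw [← Real.exp_log hb, ← Real.exp_nat_mul, ← Real.exp_add, Real.exp_le_exp]
      refine overlap_exponent_le hε hε4 hx0 hη.le hC hγB hηdef hk0.le hkC hkB (by linarith) hl2
        hB.le ?_
      rw [Real.log_div (by positivity) hW0.ne']
      refine sub_le_sub ((Real.log_le_iff_le_exp (by positivity)).2 (le_trans ?_ hxε))
        ((Real.le_log_iff_exp_le hW0).2 hW)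
      rw [← mul_pow]
      exact pow_le_pow_left₀ hk0.le hkC 2
    refine (Finset.sum_le_card_nsmul _ _ _ hterm).trans ?_
    rw [nsmul_eq_mul]
    refine mul_le_mul_of_nonneg_right (Nat.cast_le.2 ?_) (Real.exp_pos _).le
    rw [Nat.card_Icc]
    omega

end LargeDependent

/-! ### Improper colourings -/

section Colouring

open SimpleGraph

variable {V : Type*} [DecidableEq V]

/-- The graph with a given vector of edge indicators. -/
def graphOf (ω : Sym2 V → Bool) : SimpleGraph V := fromEdgeSet {e | ω e = true}

theorem isDependentSet_graphOf (t : ℝ) (S : Finset V) (ω : Sym2 V → Bool) :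
    (graphOf ω).IsDependentSet t (S : Set V) ↔ DependentEvent t S ω := by
  refine forall₂_congr fun v _ => ?_
  have : {w | w ∈ (S : Set V) ∧ (graphOf ω).Adj v w} =
      ((S.filter fun w => w ≠ v ∧ ω s(v, w) = true : Finset V) : Set V) := by
    ext w
    simp only [graphOf, fromEdgeSet_adj, Set.mem_ofPred_eq, Finset.coe_filter, Finset.mem_coe]
    tauto
  rw [this, Set.ncard_coe_finset, degreeIn]

theorem dependentEvent_of_card_le_one {t : ℝ} (ht : 0 ≤ t) {S : Finset V} (hS : S.card ≤ 1)
    (ω : Sym2 V → Bool) : DependentEvent t S ω := fun v hv => by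
  have : degreeIn S v ω = 0 := Finset.card_eq_zero.2 (Finset.filter_eq_empty_iff.2
    fun w hw h => h.1 (Finset.card_le_one.1 hS w hw v hv))
  rw [this, Nat.cast_zero]
  exact ht

/-- Greedy colouring by dependent sets of size `k`. -/
theorem exists_greedy_coloring {t : ℝ} (ht : 0 ≤ t) (ω : Sym2 V → Bool) {k m : ℕ} (hk : 0 < k)
    (h : ∀ W : Finset V, W.card = m → ∃ S ⊆ W, S.card = k ∧ DependentEvent t S ω)
    (U : Finset V) : ∃ (j : ℕ) (c : V → ℕ), (∀ v ∈ U, c v < j) ∧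
      (∀ i, DependentEvent t (U.filter fun v => c v = i) ω) ∧ j * k ≤ U.card + m * k := by
  induction hn : U.card using Nat.strong_induction_on generalizing U with
  | _ n ih =>
    rcases lt_or_ge U.card m with hUm | hUm
    -- Fewer than m vertices are left and each gets its own colour; the summand `m * k` pays for
    -- them.
    · refine ⟨U.card, fun v => if hv : v ∈ U then (U.equivFin ⟨v, hv⟩ : ℕ) else 0, fun v hv => ?_,
        fun i => ?_, ?_⟩
      · simp [hv]
      · refine dependentEvent_of_card_le_one ht (Finset.card_le_one.2 fun a ha b hb => ?_) ω
        simp only [Finset.mem_filter] at ha hb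
        have hab := ha.2.trans hb.2.symm
        rw [dif_pos ha.1, dif_pos hb.1] at hab
        simpa using U.equivFin.injective (Fin.ext hab)
      · exact (Nat.mul_le_mul_right k hUm.le).trans (Nat.le_add_left _ _)
    · obtain ⟨W, hWU, hW⟩ := Finset.exists_subset_card_eq hUm
      obtain ⟨S, hSW, hS, hd⟩ := h W hW
      have hSU := hSW.trans hWU
      have hcard := Finset.card_sdiff_add_card_eq_card hSU
      obtain ⟨j, c, hc, hcd, hj⟩ := ih (U \ S).card (by omega) (U \ S) rfl
      refine ⟨j + 1, fun v => if v ∈ S then j else c v, fun v hv => ?_, fun i => ?_, ?_⟩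
      · dsimp only
        split_ifs with hvS
        · exact Nat.lt_succ_self j
        · exact (hc v (Finset.mem_sdiff.2 ⟨hv, hvS⟩)).trans (Nat.lt_succ_self j)
      · by_cases hi : i = j
        · refine hd.subset fun v hv => ?_
          obtain ⟨hvU, hvi⟩ := Finset.mem_filter.1 hv
          dsimp only at hvi
          by_contra hvS
          rw [if_neg hvS] at hvi
          exact absurd (hc v (Finset.mem_sdiff.2 ⟨hvU, hvS⟩)) (by omega)
        · refine (hcd i).subset fun v hv => ?_
          obtain ⟨hvU, hvi⟩ := Finset.mem_filter.1 hv
          dsimp only at hvi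
          by_cases hvS : v ∈ S
          · rw [if_pos hvS] at hvi
            exact absurd hvi.symm hi
          · rw [if_neg hvS] at hvi
            exact Finset.mem_filter.2 ⟨Finset.mem_sdiff.2 ⟨hvU, hvS⟩, hvi⟩
      · rw [add_mul, one_mul]
        omega

variable [Fintype V]

theorem isImproperColoring_graphOf (t : ℝ) (ω : Sym2 V → Bool) {k : ℕ} (c : V → Fin k) :
    (graphOf ω).IsImproperColoring t c ↔
      ∀ i, DependentEvent t (Finset.univ.filter fun v => c v = i) ω :=
  forall_congr' fun i => by
    rw [← isDependentSet_graphOf]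
    simp

/-- A colouring by natural numbers below `j` bounds the improper chromatic number. -/
theorem improperChromaticNumber_graphOf_le {t : ℝ} {ω : Sym2 V → Bool} {j : ℕ} (c : V → ℕ)
    (hc : ∀ v, c v < j)
    (h : ∀ i, DependentEvent t (Finset.univ.filter fun v => c v = i) ω) :
    (graphOf ω).improperChromaticNumber t ≤ j := by
  refine Nat.sInf_le ⟨fun v => ⟨c v, hc v⟩, (isImproperColoring_graphOf t ω _).2 fun i => ?_⟩
  have := h i
  simpa [Fin.ext_iff] using this

/-- An injective colouring is admissible for t ≥ 0, so the infimum is over a nonempty set, is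
attained, and is not the default value 0. -/
theorem exists_isImproperColoring {t : ℝ} (ht : 0 ≤ t) (ω : Sym2 V → Bool) :
    ∃ c : V → Fin ((graphOf ω).improperChromaticNumber t), (graphOf ω).IsImproperColoring t c := by
  refine Nat.sInf_mem (s := {k : ℕ | ∃ c : V → Fin k, (graphOf ω).IsImproperColoring t c})
    ⟨Fintype.card V, Fintype.equivFin V, (isImproperColoring_graphOf t ω _).2 fun i => ?_⟩
  refine dependentEvent_of_card_le_one ht (Finset.card_le_one.2 fun a ha b hb => ?_) ω
  simp only [Finset.mem_filter, Finset.mem_univ, true_and] at ha hb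
  exact (Fintype.equivFin V).injective (ha.trans hb.symm)

/-- Without dependent sets of size `k + 1`, every colour is used at most `k` times. -/
theorem card_le_improperChromaticNumber_mul {t : ℝ} (ht : 0 ≤ t) (ω : Sym2 V → Bool) {k : ℕ}
    (h : ∀ S : Finset V, S.card = k + 1 → ¬ DependentEvent t S ω) :
    Fintype.card V ≤ (graphOf ω).improperChromaticNumber t * k := by
  obtain ⟨c, hc⟩ := exists_isImproperColoring ht ω
  rw [isImproperColoring_graphOf] at hc
  have hclass : ∀ i, (Finset.univ.filter fun v => c v = i).card ≤ k := fun i => by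
    by_contra hlt
    obtain ⟨S, hS, hSk⟩ := Finset.exists_subset_card_eq (Nat.succ_le_of_lt (not_le.1 hlt))
    exact h S hSk ((hc i).subset hS)
  have := Finset.card_le_mul_card_image_of_maps_to (s := Finset.univ) (t := Finset.univ) (f := c)
    (fun v _ => Finset.mem_univ _) k fun i _ => hclass i
  rwa [Finset.card_univ, Finset.card_univ, Fintype.card_fin, mul_comm] at this

end Colouring

/-! ### Probabilities of graph properties -/

section Transfer

open SimpleGraph MeasureTheory

open Classical in
/-- The probability of an event on the cube. -/
noncomputable def bernoulliProb {E : Type*} [Fintype E] [DecidableEq E] (p : ℝ)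
    (Q : (E → Bool) → Prop) : ℝ :=
  bernoulliExp (fun _ => p) fun ω => if Q ω then 1 else 0

section

variable {E : Type*} [Fintype E] [DecidableEq E] {p : ℝ}

theorem bernoulliProb_mono (hp0 : 0 ≤ p) (hp1 : p ≤ 1) {Q R : (E → Bool) → Prop}
    (h : ∀ ω, Q ω → R ω) : bernoulliProb p Q ≤ bernoulliProb p R :=
  bernoulliExp_mono (fun _ => hp0) (fun _ => hp1) fun ω => by
    by_cases hQ : Q ω
    · rw [if_pos hQ, if_pos (h ω hQ)]
    · rw [if_neg hQ]
      split_ifs <;> norm_num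

theorem bernoulliProb_not (Q : (E → Bool) → Prop) :
    bernoulliProb p (fun ω => ¬ Q ω) = 1 - bernoulliProb p Q := by
  classical
  unfold bernoulliProb
  have h1 := bernoulliExp_sub (fun _ : E => p) (fun _ => 1) (fun ω => if Q ω then 1 else 0)
  rw [bernoulliExp_const] at h1
  rw [← h1]
  congr 1
  ext ω
  by_cases hQ : Q ω <;> simp [hQ]

theorem bernoulliProb_or_le (hp0 : 0 ≤ p) (hp1 : p ≤ 1) (Q R : (E → Bool) → Prop) :
    bernoulliProb p (fun ω => Q ω ∨ R ω) ≤ bernoulliProb p Q + bernoulliProb p R := by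
  unfold bernoulliProb
  rw [← bernoulliExp_add]
  refine bernoulliExp_mono (fun _ => hp0) (fun _ => hp1) fun ω => ?_
  by_cases hQ : Q ω <;> by_cases hR : R ω <;> simp [hQ, hR]

/-- The union bound. -/
theorem bernoulliProb_exists_le (hp0 : 0 ≤ p) (hp1 : p ≤ 1) {ι : Type*} (s : Finset ι)
    (Q : ι → (E → Bool) → Prop) :
    bernoulliProb p (fun ω => ∃ i ∈ s, Q i ω) ≤ ∑ i ∈ s, bernoulliProb p (Q i) := by
  classical
  unfold bernoulliProb
  rw [← bernoulliExp_sum]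
  refine bernoulliExp_mono (fun _ => hp0) (fun _ => hp1) fun ω => ?_
  have h0 : ∀ i ∈ s, (0 : ℝ) ≤ if Q i ω then 1 else 0 := fun i _ => by split_ifs <;> norm_num
  split_ifs with h
  · obtain ⟨i, hi, hQ⟩ := h
    refine le_trans (le_of_eq ?_) (Finset.single_le_sum h0 hi)
    rw [if_pos hQ]
  · exact Finset.sum_nonneg h0

end

variable {V : Type*} [Fintype V] [DecidableEq V]

-- The diagonal coordinates do not affect the graph and integrate to 1; the others give the weight
-- of `G` in the binomial model.
open Classical in
theorem bernoulliProb_graphOf_eq (p : unitInterval) (G : SimpleGraph V) :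
    bernoulliProb (p : ℝ) (fun ω : Sym2 V → Bool => graphOf ω = G) =
      (binomialRandom V p).real {G} := by
  let φ : Sym2 V → Bool → ℝ := fun e b =>
    if e.IsDiag then 1 else if (b = true ↔ e ∈ G.edgeSet) then 1 else 0
  have h1 : ∀ ω : Sym2 V → Bool, (if graphOf ω = G then (1 : ℝ) else 0) = ∏ e, φ e (ω e) := by
    intro ω
    by_cases h : graphOf ω = G
    · rw [if_pos h]
      refine (Finset.prod_eq_one fun e _ => ?_).symm
      simp only [φ]
      split_ifs with h1 h2
      · rfl
      · rfl
      · refine absurd ?_ h2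
        rw [← h, graphOf, edgeSet_fromEdgeSet]
        simp [h1]
    · rw [if_neg h]
      have : ∃ e : Sym2 V, ¬ e.IsDiag ∧ ¬ (ω e = true ↔ e ∈ G.edgeSet) := by
        by_contra hcon
        push Not at hcon
        refine h (edgeSet_injective ?_)
        ext e
        by_cases he : e.IsDiag
        · exact ⟨fun h' => absurd he (not_isDiag_of_mem_edgeSet _ h'),
            fun h' => absurd he (not_isDiag_of_mem_edgeSet _ h')⟩
        · rw [← hcon e he, graphOf, edgeSet_fromEdgeSet]
          simp [he]
      obtain ⟨e, he1, he2⟩ := this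
      exact (Finset.prod_eq_zero (Finset.mem_univ e) (by simp only [φ]; rw [if_neg he1, if_neg he2])).symm
  unfold bernoulliProb
  simp only [h1]
  rw [bernoulliExp_prod]
  have h2 : ∀ e : Sym2 V, (p : ℝ) * φ e true + (1 - p) * φ e false =
      if e.IsDiag then 1 else if e ∈ G.edgeSet then (p : ℝ) else 1 - p := fun e => by
    by_cases h : e.IsDiag <;> by_cases h' : e ∈ G.edgeSet <;> simp [φ, h, h']
  simp only [h2]
  set D : Finset (Sym2 V) := Finset.univ.filter fun e => ¬ e.IsDiag
  have h3 : ∏ e : Sym2 V, (if e.IsDiag then (1 : ℝ) else if e ∈ G.edgeSet then (p : ℝ) else 1 - p) =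
      ∏ e ∈ D, if e ∈ G.edgeSet then (p : ℝ) else 1 - p := by
    rw [Finset.prod_filter]
    exact Finset.prod_congr rfl fun e _ => by by_cases h : e.IsDiag <;> simp [h]
  have hDcard : D.card = (Nat.card V).choose 2 := by
    rw [Nat.card_eq_fintype_card, ← Sym2.card_subtype_not_diag, Fintype.card_subtype]
  have hE : ((D.filter fun e => e ∈ G.edgeSet).card) = G.edgeSet.ncard := by
    rw [← Set.ncard_coe_finset]
    congr 1
    ext e
    simp only [D, Finset.coe_filter, Finset.mem_filter, Finset.mem_univ, true_and, Set.mem_ofPred_eq]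
    exact ⟨fun h => h.2, fun h => ⟨not_isDiag_of_mem_edgeSet _ h, h⟩⟩
  have hE' : (D.filter fun e => e ∉ G.edgeSet).card = (Nat.card V).choose 2 - G.edgeSet.ncard := by
    rw [← hDcard, ← hE, ← Finset.card_filter_add_card_filter_not (s := D) (fun e => e ∈ G.edgeSet)]
    simp
  rw [h3, Finset.prod_ite, Finset.prod_const, Finset.prod_const, hE, hE', Measure.real,
    binomialRandom_singleton]
  simp

/-- The bridge to the random graph: there are finitely many graphs, so it suffices to compare atoms.
-/
theorem binomialRandom_real_eq (p : unitInterval) (Q : SimpleGraph V → Prop) :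
    (binomialRandom V p).real {G | Q G} =
      bernoulliProb (p : ℝ) (fun ω : Sym2 V → Bool => Q (graphOf ω)) := by
  classical
  have : MeasurableSingletonClass (SimpleGraph V) := ⟨fun G => by
    have : {G} = edgeSet ⁻¹' {G.edgeSet} := by
      ext H
      simp
    rw [this]
    exact measurable_edgeSet (measurableSet_singleton _)⟩
  have h1 : {G | Q G} = ((Finset.univ.filter Q : Finset (SimpleGraph V)) : Set (SimpleGraph V)) := by
    simp
  rw [h1, ← sum_measureReal_singleton]
  simp only [← bernoulliProb_graphOf_eq, bernoulliProb]
  rw [← bernoulliExp_sum]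
  congr 1
  ext ω
  rw [Finset.sum_ite_eq]
  simp

theorem holdsAAS_of_tendsto {p : unitInterval} {P : ∀ n : ℕ, SimpleGraph (Fin n) → Prop}
    {f : ℕ → ℝ} (hf : Tendsto f atTop (𝓝 0))
    (h : ∀ᶠ n in atTop,
      bernoulliProb (p : ℝ) (fun ω : Sym2 (Fin n) → Bool => ¬ P n (graphOf ω)) ≤ f n) :
    HoldsAAS p P := by
  have h1 : Tendsto (fun n => 1 - f n) atTop (𝓝 1) := by simpa using hf.const_sub 1
  refine tendsto_of_tendsto_of_tendsto_of_le_of_le' h1 tendsto_const_nhds ?_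
    (Eventually.of_forall fun n => measureReal_le_one)
  filter_upwards [h] with n hn
  rw [binomialRandom_real_eq]
  rw [bernoulliProb_not] at hn
  linarith

end Transfer

/-! ### Bounds for the improper chromatic number -/

section Bounds

variable {p : ℝ}

/-- The first moment bound for dependent sets of size `k`. -/
theorem bernoulliProb_exists_dependentEvent_le (hp0 : 0 ≤ p) (hp1 : p < 1) {n : ℕ} (hn : 0 < n)
    (t : ℝ) {l : ℝ} (hl : 0 ≤ l) (k : ℕ) :
    bernoulliProb p (fun ω : Sym2 (Fin n) → Bool =>
      ∃ S : Finset (Fin n), S.card = k ∧ DependentEvent t S ω) ≤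
      Real.exp (k * Real.log n - k / 2 * ((k - 1) * negLogLaplace p l - l * t)) := by
  have h1 : ∀ S ∈ (Finset.univ : Finset (Fin n)).powersetCard k,
      bernoulliProb p (fun ω => DependentEvent t S ω) ≤
        Real.exp (-((k : ℝ) / 2 * ((k - 1) * negLogLaplace p l - l * t))) := fun S hS => by
    have := bernoulliExp_dependentInd_le hp0 hp1 t hl S
    rw [(Finset.mem_powersetCard.1 hS).2] at this
    exact this
  have h2 : (n.choose k : ℝ) ≤ Real.exp (k * Real.log n) := by
    rw [Real.exp_nat_mul, Real.exp_log (Nat.cast_pos.2 hn)]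
    exact_mod_cast Nat.choose_le_pow n k
  refine (bernoulliProb_mono hp0 hp1.le (R := fun ω => ∃ S ∈
    (Finset.univ : Finset (Fin n)).powersetCard k, DependentEvent t S ω) fun ω => ?_).trans
    ((bernoulliProb_exists_le hp0 hp1.le _ _).trans
      ((Finset.sum_le_card_nsmul _ _ _ h1).trans ?_))
  · rintro ⟨S, hS, hd⟩
    exact ⟨S, Finset.mem_powersetCard.2 ⟨Finset.subset_univ S, hS⟩, hd⟩
  · rw [Finset.card_powersetCard, Finset.card_univ, Fintype.card_fin, nsmul_eq_mul,
      sub_eq_add_neg (_ * Real.log _), Real.exp_add]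
    exact mul_le_mul_of_nonneg_right h2 (Real.exp_pos _).le

/-- Colouring consecutive blocks of `s` vertices with one colour each. -/
theorem bernoulliProb_lt_improperChromaticNumber_le (hp0 : 0 ≤ p) (hp1 : p ≤ 1) {n r s : ℕ}
    (hs : 0 < s) (hn : n ≤ r * s) {t σ : ℝ} (hσ0 : 0 ≤ σ) (hσ1 : σ ≤ 1) (ht : (p + σ) * s ≤ t) :
    bernoulliProb p (fun ω : Sym2 (Fin n) → Bool =>
      ¬ (graphOf ω).improperChromaticNumber t ≤ r) ≤ n * Real.exp (-(σ ^ 2 / 4 * s)) := by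
  -- The block of `v`. The partition is fixed in advance, so a union bound over n degrees is enough.
  let B : Fin n → Finset (Fin n) := fun v =>
    Finset.univ.filter fun w => (w : ℕ) / s = (v : ℕ) / s
  have hB : ∀ v, (B v).card ≤ s := fun v => by
    have : ((B v).map Fin.valEmbedding) ⊆
        Finset.Ico ((v : ℕ) / s * s) ((v : ℕ) / s * s + s) := fun w hw => by
      obtain ⟨w, hwB, rfl⟩ := Finset.mem_map.1 hw
      have h1 := (Finset.mem_filter.1 hwB).2
      rw [Finset.mem_Ico, Fin.valEmbedding_apply, ← h1]
      exact ⟨Nat.div_mul_le_self _ _, by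
        have := Nat.lt_div_mul_add (a := (w : ℕ)) hs
        omega⟩
    have := Finset.card_le_card this
    rwa [Finset.card_map, Nat.card_Ico, Nat.add_sub_cancel_left] at this
  refine (bernoulliProb_mono hp0 hp1 (R := fun ω => ∃ v ∈ (Finset.univ : Finset (Fin n)),
    t < degreeIn (B v) v ω) fun ω hω => ?_).trans ((bernoulliProb_exists_le hp0 hp1 _ _).trans
      ((Finset.sum_le_card_nsmul _ _ (Real.exp (-(σ ^ 2 / 4 * s))) fun v _ => ?_).trans ?_))
  · by_contra hcon
    push Not at hcon
    refine hω (improperChromaticNumber_graphOf_le (fun v => (v : ℕ) / s) (fun v => ?_)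
      fun i v hv => ?_)
    · exact (Nat.div_lt_iff_lt_mul hs).2 (v.2.trans_le hn)
    · have hi := (Finset.mem_filter.1 hv).2
      rw [← hi]
      exact hcon v (Finset.mem_univ v)
  · exact bernoulliExp_degreeIn_tail_le (fun _ => hp0) (fun _ => hp1) hp0 hp1 (B v) v
      (fun _ _ => rfl) hσ0 hσ1 (Nat.cast_le.2 (hB v)) ht
  · rw [Finset.card_univ, Fintype.card_fin, nsmul_eq_mul]

/-- Greedy colouring succeeds if every vertex set of size `m` contains a dependent set of
size `k`. -/
theorem bernoulliProb_greedy_le (hp0 : 0 ≤ p) (hp1 : p ≤ 1) {n k m : ℕ} (hk : 0 < k) {t : ℝ}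
    (ht : 0 ≤ t) (hW : ∀ W : Finset (Fin n), W.card = m → bernoulliExp (fun _ => p)
      (fun ω => ∏ S ∈ W.powersetCard k, (1 - dependentInd t S ω)) ≤ Real.exp (-(2 * n))) :
    bernoulliProb p (fun ω : Sym2 (Fin n) → Bool =>
      ¬ ((graphOf ω).improperChromaticNumber t : ℝ) ≤ n / k + m) ≤ Real.exp (-n) := by
  have h1 : ∀ W ∈ (Finset.univ : Finset (Fin n)).powersetCard m,
      bernoulliProb p (fun ω => ∀ S ∈ W.powersetCard k, ¬ DependentEvent t S ω) ≤
        Real.exp (-(2 * n)) := fun W hWm => by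
    refine le_trans (bernoulliExp_mono (fun _ => hp0) (fun _ => hp1) fun ω => ?_)
      (hW W (Finset.mem_powersetCard.1 hWm).2)
    split_ifs with h
    · refine (Finset.prod_eq_one fun S hS => ?_).symm.le
      rw [dependentInd, if_neg (h S hS), sub_zero]
    · exact Finset.prod_nonneg fun S _ => sub_nonneg.2 (dependentInd_le_one t S ω)
  -- The choice of the set costs e^n, half of the exponent 2n.
  have h2 : (n.choose m : ℝ) ≤ Real.exp n := by
    have h3 : (n.choose m : ℝ) ≤ 2 ^ n := by exact_mod_cast Nat.choose_le_two_pow n m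
    refine h3.trans ?_
    have h4 : (2 : ℝ) ≤ Real.exp 1 := by linarith [Real.add_one_le_exp 1]
    calc (2 : ℝ) ^ n ≤ Real.exp 1 ^ n := pow_le_pow_left₀ (by norm_num) h4 n
      _ = Real.exp n := by rw [← Real.exp_nat_mul, mul_one]
  refine (bernoulliProb_mono hp0 hp1 (R := fun ω => ∃ W ∈
    (Finset.univ : Finset (Fin n)).powersetCard m,
      ∀ S ∈ W.powersetCard k, ¬ DependentEvent t S ω) fun ω hω => ?_).trans
    ((bernoulliProb_exists_le hp0 hp1 _ _).trans
      ((Finset.sum_le_card_nsmul _ _ _ h1).trans ?_))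
  · by_contra hcon
    push Not at hcon
    obtain ⟨j, c, hc, hcd, hj⟩ := exists_greedy_coloring ht ω hk (m := m) (fun W hWm => by
      obtain ⟨S, hS, hd⟩ := hcon W (Finset.mem_powersetCard.2 ⟨Finset.subset_univ W, hWm⟩)
      obtain ⟨hSW, hSk⟩ := Finset.mem_powersetCard.1 hS
      exact ⟨S, hSW, hSk, hd⟩) Finset.univ
    refine hω ((Nat.cast_le.2 (improperChromaticNumber_graphOf_le c
      (fun v => hc v (Finset.mem_univ v)) hcd)).trans ?_)
    rw [Finset.card_univ, Fintype.card_fin] at hj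
    have hj' : (j : ℝ) * k ≤ n + m * k := by exact_mod_cast hj
    have hk' : (0 : ℝ) < k := Nat.cast_pos.2 hk
    rw [div_add' _ _ _ hk'.ne', le_div_iff₀ hk']
    exact hj'
  · rw [Finset.card_powersetCard, Finset.card_univ, Fintype.card_fin, nsmul_eq_mul]
    refine (mul_le_mul_of_nonneg_right h2 (Real.exp_pos _).le).trans (le_of_eq ?_)
    rw [← Real.exp_add]
    congr 1
    ring

/-- The lower bound on the improper chromatic number, uniformly in `t`. -/
theorem eventually_bernoulliProb_lower_le (hp0 : 0 < p) (hp1 : p < 1) {ε : ℝ} (hε : 0 < ε)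
    (hε1 : ε ≤ 1) :
    ∀ᶠ n : ℕ in atTop, ∀ t : ℝ, 0 ≤ t → bernoulliProb p (fun ω : Sym2 (Fin n) → Bool =>
      ¬ (1 - ε) * (n / (kappa p (t / Real.log n) * Real.log n)) ≤
        ((graphOf ω).improperChromaticNumber t : ℝ)) ≤ Real.exp (-(ε / 8 * Real.log n)) := by
  have hκ0 := kappa_zero_pos hp0 hp1
  filter_upwards [tendsto_log_natCast.eventually_gt_atTop 0,
    tendsto_log_natCast.eventually_ge_atTop (4 / (ε * kappa p 0)), eventually_gt_atTop 0]
    with n hx hxκ hn t ht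
  set x := Real.log n
  have hτ : 0 ≤ t / x := div_nonneg ht hx.le
  set κ := kappa p (t / x)
  have hκ : kappa p 0 ≤ κ := kappa_mono hp0 hp1 le_rfl hτ
  have hκpos : 0 < κ := hκ0.trans_le hκ
  set K := κ * x
  have hK : 0 < K := mul_pos hκpos hx
  have hK4 : 1 ≤ ε / 4 * K := by
    rw [div_le_iff₀ (by positivity)] at hxκ
    have := mul_le_mul_of_nonneg_right hκ hx.le
    nlinarith
  -- A near-optimal l, which may depend on n and t since the first moment bound holds for every l.
  -- The margin from 1 + ε/2 to 1 + ε makes the first moment vanish.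
  obtain ⟨l, hl, hlt⟩ := exists_lt_of_kappa_lt (p := p) (τ := t / x) (c := (1 + ε / 2) * κ)
    (show κ < _ by nlinarith)
  have hL := negLogLaplace_pos hp0 hp1 hl
  rw [div_lt_iff₀ hL] at hlt
  set k := ⌊(1 + ε) * K⌋₊
  have hk1 : (k : ℝ) ≤ (1 + ε) * K := Nat.floor_le (by positivity)
  have hk2 : (1 + ε) * K < k + 1 := Nat.lt_floor_add_one _
  refine (bernoulliProb_mono hp0.le hp1.le (R := fun ω =>
    ∃ S : Finset (Fin n), S.card = k + 1 ∧ DependentEvent t S ω) fun ω hω => ?_).trans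
    ((bernoulliProb_exists_dependentEvent_le hp0.le hp1 hn t hl.le (k + 1)).trans
      (Real.exp_le_exp.2 ?_))
  · by_contra hcon
    push Not at hcon
    have h1 := card_le_improperChromaticNumber_mul ht ω hcon
    rw [Fintype.card_fin] at h1
    have h2 : (n : ℝ) ≤ (graphOf ω).improperChromaticNumber t * k := by exact_mod_cast h1
    refine hω ?_
    rw [← mul_div_assoc, div_le_iff₀ hK]
    set χ : ℝ := ((graphOf ω).improperChromaticNumber t : ℝ)
    have hχ : 0 ≤ χ := Nat.cast_nonneg _
    calc (1 - ε) * n ≤ (1 - ε) * (χ * ((1 + ε) * K)) :=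
          mul_le_mul_of_nonneg_left (h2.trans (mul_le_mul_of_nonneg_left hk1 hχ)) (by linarith)
      _ = χ * K - ε ^ 2 * (χ * K) := by ring
      _ ≤ χ * K := by linarith [mul_nonneg (sq_nonneg ε) (mul_nonneg hχ hK.le)]
  · push_cast
    have h1 : 2 * x + l * t ≤ (1 + ε / 2) * (K * negLogLaplace p l) := by
      have := mul_le_mul_of_nonneg_left hlt.le hx.le
      have h2 : x * (2 + l * (t / x)) = 2 * x + l * t := by field_simp
      rw [h2] at this
      refine this.trans (le_of_eq ?_)
      simp only [K]
      ring
    have h2 : (1 + 3 * ε / 4) * (K * negLogLaplace p l) ≤ k * negLogLaplace p l := by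
      rw [← mul_assoc]
      exact mul_le_mul_of_nonneg_right (by linarith) hL.le
    have h3 : (1 + ε / 8) * (2 * x + l * t) ≤ (1 + 3 * ε / 4) * (K * negLogLaplace p l) := by
      refine (mul_le_mul_of_nonneg_left h1 (by positivity)).trans ?_
      rw [← mul_assoc]
      exact mul_le_mul_of_nonneg_right (by nlinarith) (mul_nonneg hK.le hL.le)
    have h4 : 2 * x + ε / 4 * x ≤ k * negLogLaplace p l - l * t := by
      linarith [mul_nonneg hε.le (mul_nonneg hl.le ht)]
    have hk0 : (0 : ℝ) ≤ k := Nat.cast_nonneg k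
    have h5 := mul_le_mul_of_nonneg_left h4 (show (0 : ℝ) ≤ ((k : ℝ) + 1) / 2 by positivity)
    rw [add_sub_cancel_right]
    nlinarith [mul_nonneg hk0 (mul_nonneg hε.le hx.le)]

/-- The upper bound on the improper chromatic number for `t = O(ln n)`, by greedy colouring. -/
theorem eventually_bernoulliProb_upper_le_of_le (hp0 : 0 < p) (hp1 : p < 1) {ε T : ℝ}
    (hε : 0 < ε) (hε1 : ε ≤ 1) (hT : 0 ≤ T) :
    ∀ᶠ n : ℕ in atTop, ∀ t : ℝ, 0 ≤ t → t ≤ T * Real.log n →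
      bernoulliProb p (fun ω : Sym2 (Fin n) → Bool =>
        ¬ ((graphOf ω).improperChromaticNumber t : ℝ) ≤
          (1 + ε) * (n / (kappa p (t / Real.log n) * Real.log n))) ≤ Real.exp (-n) := by
  have hκ0 := kappa_zero_pos hp0 hp1
  -- Error budget: the greedy classes cost 4δ, the leftover vertices δ, out of ε = 8δ.
  set δ := ε / 8 with hδ
  have hδ0 : 0 < δ := by positivity
  have hδ8 : δ ≤ 1 / 8 := by linarith
  set C := kappa p T
  have hC : 0 < C := kappa_pos hp0 hp1 hT
  filter_upwards [tendsto_log_natCast.eventually_ge_atTop 1,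
    tendsto_log_natCast.eventually_ge_atTop (1 / (δ * kappa p 0)),
    tendsto_log_natCast.eventually (eventually_mul_sq_le_exp (2 * C / δ)
      (show 0 < δ / 4 by positivity)), eventually_gt_atTop 0,
    eventually_forall_bernoulliExp_prod_le hp0 hp1 hδ0 (by linarith) hT
      (show 0 < kappa p 0 / 2 by positivity)]
    with n hx1 hxκ hxm hn hjanson t ht htT
  set x := Real.log n
  have hx : 0 < x := by linarith
  have hn0 : (0 : ℝ) < n := Nat.cast_pos.2 hn
  have hnx : Real.exp x = n := Real.exp_log hn0
  have hτ : 0 ≤ t / x := div_nonneg ht hx.le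
  set κ := kappa p (t / x)
  have hκ : kappa p 0 ≤ κ := kappa_mono hp0 hp1 le_rfl hτ
  have hκC : κ ≤ C := kappa_mono hp0 hp1 hτ ((div_le_iff₀ hx).2 htT)
  have hκpos : 0 < κ := hκ0.trans_le hκ
  set K := κ * x
  have hK : 0 < K := mul_pos hκpos hx
  have hKκ0 : kappa p 0 * x ≤ K := mul_le_mul_of_nonneg_right hκ hx.le
  have hKC : K ≤ C * x ^ 2 := by
    have h1 : K ≤ C * x := mul_le_mul_of_nonneg_right hκC hx.le
    have h2 : C * x ≤ C * x ^ 2 := by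
      rw [pow_two]
      exact mul_le_mul_of_nonneg_left (le_mul_of_one_le_left hx.le hx1) hC.le
    exact h1.trans h2
  have hδK : 1 ≤ δ * K := by
    rw [div_le_iff₀ (by positivity)] at hxκ
    nlinarith
  set k := ⌊(1 - δ) * K⌋₊
  have hk1 : (k : ℝ) ≤ (1 - δ) * K := Nat.floor_le (mul_nonneg (by linarith) hK.le)
  have hk2 : (1 - 2 * δ) * K ≤ k := by
    have := Nat.lt_floor_add_one ((1 - δ) * K)
    linarith
  have hkpos : (0 : ℝ) < k := lt_of_lt_of_le (mul_pos (by linarith) hK) hk2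
  set m := ⌈Real.exp ((1 - δ / 4) * x)⌉₊
  have hm1 : Real.exp ((1 - δ / 4) * x) ≤ m := Nat.le_ceil _
  have hm2 : (m : ℝ) ≤ 2 * Real.exp ((1 - δ / 4) * x) := by
    have h1 := (Nat.ceil_lt_add_one (Real.exp_pos ((1 - δ / 4) * x)).le).le
    have h2 : 1 ≤ Real.exp ((1 - δ / 4) * x) :=
      Real.one_le_exp (mul_nonneg (by linarith) hx.le)
    linarith
  have hmK : (m : ℝ) ≤ δ * (n / K) := by
    rw [← mul_div_assoc, le_div_iff₀ hK]
    have h1 : 2 * K ≤ δ * Real.exp (δ / 4 * x) := by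
      rw [div_mul_eq_mul_div, div_le_iff₀ hδ0] at hxm
      linarith
    calc (m : ℝ) * K ≤ 2 * Real.exp ((1 - δ / 4) * x) * K :=
          mul_le_mul_of_nonneg_right hm2 hK.le
      _ = Real.exp ((1 - δ / 4) * x) * (2 * K) := by ring
      _ ≤ Real.exp ((1 - δ / 4) * x) * (δ * Real.exp (δ / 4 * x)) :=
          mul_le_mul_of_nonneg_left h1 (Real.exp_pos _).le
      _ = δ * Real.exp x := by
          rw [mul_left_comm, ← Real.exp_add]
          congr 2
          ring
      _ = δ * n := by rw [hnx]
  have key := bernoulliProb_greedy_le hp0.le hp1.le (Nat.cast_pos.1 hkpos) ht (m := m)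
    fun W hW => hjanson t ht htT k (by nlinarith) hk1 W (by rw [hW]; exact hm1)
  refine key.trans' (bernoulliProb_mono hp0.le hp1.le fun ω hω hle => hω (hle.trans ?_))
  have h1 : (n : ℝ) / k ≤ (1 + 4 * δ) * (n / K) := by
    rw [← mul_div_assoc, div_le_div_iff₀ hkpos hK]
    have h2 : 1 ≤ (1 + 4 * δ) * (1 - 2 * δ) := by nlinarith
    calc (n : ℝ) * K ≤ (1 + 4 * δ) * (1 - 2 * δ) * (n * K) :=
          le_mul_of_one_le_left (mul_nonneg hn0.le hK.le) h2
      _ = (1 + 4 * δ) * n * ((1 - 2 * δ) * K) := by ring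
      _ ≤ _ := mul_le_mul_of_nonneg_left hk2 (by positivity)
  have h2 : 0 ≤ (n : ℝ) / K := by positivity
  have h3 : (1 + ε) * ((n : ℝ) / K) = (1 + 4 * δ) * (n / K) + δ * (n / K) + 3 * (δ * (n / K)) := by
    rw [hδ]; ring
  rw [h3]
  linarith [mul_nonneg hδ0.le h2]

/-- The upper bound on the improper chromatic number when `t / ln n` is large. -/
theorem exists_eventually_bernoulliProb_upper_le_of_ge (hp0 : 0 < p) (hp1 : p < 1) {ε : ℝ}
    (hε : 0 < ε) (hε1 : ε ≤ 1) : ∃ T c : ℝ, 0 < T ∧ 0 < c ∧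
    ∀ᶠ n : ℕ in atTop, ∀ t : ℝ, T * Real.log n ≤ t → t ≤ c * n →
      bernoulliProb p (fun ω : Sym2 (Fin n) → Bool =>
        ¬ ((graphOf ω).improperChromaticNumber t : ℝ) ≤
          (1 + ε) * (n / (kappa p (t / Real.log n) * Real.log n))) ≤ Real.exp (-Real.log n) := by
  set δ := ε / 8 with hδ
  have hδ0 : 0 < δ := by positivity
  have hδ8 : δ ≤ 1 / 8 := by linarith
  obtain ⟨T₀, hT₀, hκT⟩ := exists_kappa_le hp0 hp1 hδ0
  -- `T₀` makes κ close to τ/p, 6/δ makes the rounding of the block size negligible, and the last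
  -- term makes the union bound over n vertices at most 1/n.
  set T := max T₀ (max (6 / δ) (16 / (δ ^ 2 * p ^ 2)))
  have hT1 : T₀ ≤ T := le_max_left _ _
  have hT2 : 6 / δ ≤ T := (le_max_left _ _).trans (le_max_right _ _)
  have hT3 : 16 / (δ ^ 2 * p ^ 2) ≤ T := (le_max_right _ _).trans (le_max_right _ _)
  have hT : 0 < T := hT₀.trans_le hT1
  -- The bound t ≤ δpn gives np/t ≥ 1/δ, so rounding up the number of blocks costs a proportion δ.
  refine ⟨T, δ * p, hT, by positivity, ?_⟩
  filter_upwards [tendsto_log_natCast.eventually_ge_atTop 1, eventually_gt_atTop 0]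
    with n hx1 hn t htT htc
  set x := Real.log n
  have hx : 0 < x := by linarith
  have hn0 : (0 : ℝ) < n := Nat.cast_pos.2 hn
  have hnx : Real.exp x = n := Real.exp_log hn0
  have hTt : T ≤ t := le_trans (le_mul_of_one_le_right hT.le hx1) htT
  have ht : 0 < t := hT.trans_le hTt
  have hτ : T₀ ≤ t / x := hT1.trans ((le_div_iff₀ hx).2 htT)
  have hτ0 : 0 ≤ t / x := hT₀.le.trans hτ
  set K := kappa p (t / x) * x
  have hK : 0 < K := mul_pos (kappa_pos hp0 hp1 hτ0) hx
  have hKt : K * p ≤ (1 + δ) * t := by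
    have := mul_le_mul_of_nonneg_right (hκT _ hτ) hx.le
    have h2 : (1 + δ) * (t / x / p) * x * p = (1 + δ) * t := by field_simp
    rw [← h2]
    exact mul_le_mul_of_nonneg_right this hp0.le
  set s := ⌊t / ((1 + δ) * p)⌋₊
  have hs1 : (p + δ * p) * s ≤ t := by
    have := Nat.floor_le (show 0 ≤ t / ((1 + δ) * p) by positivity)
    rw [le_div_iff₀ (by positivity)] at this
    linarith
  have hs2 : t ≤ (1 + 2 * δ) * p * s := by
    have h1 := (Nat.lt_floor_add_one (t / ((1 + δ) * p))).le
    rw [div_le_iff₀ (by positivity)] at h1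
    have h2 : 6 ≤ t * δ := (div_le_iff₀ hδ0).1 (hT2.trans hTt)
    have h3 : (1 + δ) * p ≤ 2 := by nlinarith
    have h4 : t ≤ s * ((1 + δ) * p) + (1 + δ) * p := by linarith
    nlinarith
  have hs0 : (0 : ℝ) < s := by
    by_contra hcon
    have : (1 + 2 * δ) * p * s ≤ 0 :=
      mul_nonpos_of_nonneg_of_nonpos (by positivity) (not_lt.1 hcon)
    linarith
  have hst : t ≤ 2 * s := by
    refine hs2.trans (mul_le_mul_of_nonneg_right ?_ hs0.le)
    nlinarith
  have hspos : 0 < s := Nat.cast_pos.1 hs0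
  set r := ⌈(n : ℝ) / s⌉₊
  have hr1 : n ≤ r * s := by
    have := Nat.le_ceil ((n : ℝ) / s)
    rw [div_le_iff₀ hs0] at this
    exact_mod_cast this
  have hr2 : (r : ℝ) ≤ n / s + 1 := (Nat.ceil_lt_add_one (by positivity)).le
  have key := bernoulliProb_lt_improperChromaticNumber_le hp0.le hp1.le hspos hr1
    (show 0 ≤ δ * p by positivity) (by nlinarith) hs1
  refine (key.trans ?_).trans' (bernoulliProb_mono hp0.le hp1.le fun ω hω hle => hω ?_)
  · rw [← hnx, ← Real.exp_add, Real.exp_le_exp]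
    rw [div_le_iff₀ (by positivity)] at hT3
    have h1 : T * x ≤ 2 * s := htT.trans hst
    have h2 := mul_le_mul_of_nonneg_left h1 (show 0 ≤ (δ * p) ^ 2 by positivity)
    have h3 := mul_le_mul_of_nonneg_right hT3 hx.le
    nlinarith
  · refine (Nat.cast_le.2 hle).trans (hr2.trans ?_)
    have h1 : (n : ℝ) / s ≤ (1 + 2 * δ) * (n * p / t) := by
      rw [← mul_div_assoc, div_le_div_iff₀ hs0 ht]
      calc (n : ℝ) * t ≤ n * ((1 + 2 * δ) * p * s) := mul_le_mul_of_nonneg_left hs2 hn0.le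
        _ = _ := by ring
    have h2 : 1 ≤ δ * (n * p / t) := by
      rw [← mul_div_assoc, le_div_iff₀ ht]
      linarith
    have h3 : n * p / t ≤ (1 + δ) * (n / K) := by
      rw [← mul_div_assoc, div_le_div_iff₀ ht hK]
      calc (n : ℝ) * p * K = n * (K * p) := by ring
        _ ≤ n * ((1 + δ) * t) := mul_le_mul_of_nonneg_left hKt hn0.le
        _ = _ := by ring
    have h4 : 0 ≤ (n : ℝ) / K := by positivity
    have h5 : (1 + 3 * δ) * (1 + δ) ≤ 1 + ε := by nlinarith
    calc (n : ℝ) / s + 1 ≤ (1 + 3 * δ) * (n * p / t) := by linarith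
      _ ≤ (1 + 3 * δ) * ((1 + δ) * (n / K)) := mul_le_mul_of_nonneg_left h3 (by positivity)
      _ = (1 + 3 * δ) * (1 + δ) * (n / K) := by ring
      _ ≤ _ := mul_le_mul_of_nonneg_right h5 h4

theorem tendsto_natCast_mul_exp_neg {a : ℝ} (ha : 0 < a) :
    Tendsto (fun n : ℕ => (n : ℝ) * Real.exp (-(a * n))) atTop (𝓝 0) := by
  have h := ((Real.tendsto_pow_mul_exp_neg_atTop_nhds_zero 1).comp
    ((tendsto_natCast_atTop_atTop (R := ℝ)).const_mul_atTop ha)).const_mul a⁻¹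
  rw [mul_zero] at h
  refine h.congr fun n => ?_
  simp only [Function.comp_apply, pow_one]
  field_simp

/-- For `t ∼ np / x`, at least `⌊x⌋ + 1` colours are needed. -/
theorem eventually_bernoulliProb_le_of_linear (hp0 : 0 < p) (hp1 : p < 1) {x : ℝ} (hx : 0 < x)
    {r : ℕ} (hrx : (r : ℝ) < x) {t : ℕ → ℝ} (ht0 : ∀ n, 0 ≤ t n)
    (ht : ∀ c, 1 < c → ∀ᶠ n : ℕ in atTop, t n ≤ c * (n * p / x)) :
    ∀ᶠ n : ℕ in atTop, bernoulliProb p (fun ω : Sym2 (Fin n) → Bool =>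
      (graphOf ω).improperChromaticNumber (t n) ≤ r) ≤ Real.exp (-Real.log n) := by
  rcases Nat.eq_zero_or_pos r with rfl | hr
  · filter_upwards [eventually_gt_atTop 0] with n hn
    refine le_trans (le_of_eq ?_) (Real.exp_pos _).le
    refine (Finset.sum_eq_zero fun ω _ => ?_)
    refine mul_eq_zero_of_right _ (if_neg fun h => ?_)
    obtain ⟨c, -⟩ := exists_isImproperColoring (ht0 n) ω
    have := (c ⟨0, hn⟩).2
    omega
  have hr0 : (0 : ℝ) < r := Nat.cast_pos.2 hr
  have hρ : (r + x) / (2 * x) < 1 := by rw [div_lt_one (by positivity)]; linarith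
  -- ρ is the midpoint of r/x and 1. Eventually t ≤ ρpn/r, while l is chosen with L(l) ≥ lp(1+ρ)/2;
  -- the gap gives an exponent linear in n with rate `a`.
  set ρ := (r + x) / (2 * x) with hρdef
  obtain ⟨l, hl, hcl⟩ := exists_mul_le_negLogLaplace (p := p) (c := p * (1 + ρ) / 2) (by nlinarith)
  set a := l * p * (1 - ρ) / (2 * r)
  have ha : 0 < a := div_pos (mul_pos (mul_pos hl hp0) (by linarith)) (by positivity)
  have hev : ∀ᶠ n : ℕ in atTop, 2 * Real.log n + p * l ≤ a / 2 * n := by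
    have h1 := (Real.isLittleO_log_id_atTop.comp_tendsto
      (tendsto_natCast_atTop_atTop (R := ℝ))).bound (c := a / 8) (by positivity)
    filter_upwards [h1, (tendsto_natCast_atTop_atTop (R := ℝ)).eventually_ge_atTop
      (p * l / (a / 4))] with n hn hn'
    simp only [Function.comp_apply, id, Real.norm_eq_abs, Nat.abs_cast] at hn
    rw [div_le_iff₀ (by positivity)] at hn'
    linarith [le_abs_self (Real.log n)]
  have hc : 1 < ρ * x / r := by
    rw [lt_div_iff₀ hr0, hρdef]
    field_simp
    linarith
  filter_upwards [ht _ hc, hev, eventually_gt_atTop 0, tendsto_log_natCast.eventually_ge_atTop 0]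
    with n htn hnev hn hlog
  have hn0 : (0 : ℝ) < n := Nat.cast_pos.2 hn
  have ht' : t n ≤ ρ * p / r * n := by
    refine htn.trans (le_of_eq ?_)
    field_simp
  -- With at most r colours some class has at least n/r vertices, hence at least k.
  set k := ⌈(n : ℝ) / r⌉₊
  have hk1 : (n : ℝ) / r ≤ k := Nat.le_ceil _
  have hkpos : 0 < k := Nat.ceil_pos.2 (by positivity)
  have hk2 : (k : ℝ) < n / r + 1 := Nat.ceil_lt_add_one (by positivity)
  refine (bernoulliProb_mono hp0.le hp1.le (R := fun ω =>
    ∃ S : Finset (Fin n), S.card = k ∧ DependentEvent (t n) S ω) fun ω hω => ?_).trans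
    ((bernoulliProb_exists_dependentEvent_le hp0.le hp1 hn (t n) hl.le k).trans
      (Real.exp_le_exp.2 ?_))
  · by_contra hcon
    push Not at hcon
    have h1 := card_le_improperChromaticNumber_mul (ht0 n) ω (k := k - 1)
      (by rwa [Nat.sub_add_cancel hkpos])
    rw [Fintype.card_fin] at h1
    have h2 : n ≤ r * (k - 1) := h1.trans (Nat.mul_le_mul_right _ hω)
    have h3 : (n : ℝ) ≤ r * (k - 1) := by
      have := (Nat.cast_le (α := ℝ)).2 h2
      rwa [Nat.cast_mul, Nat.cast_sub hkpos, Nat.cast_one] at this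
    have h4 := mul_lt_mul_of_pos_left hk2 hr0
    rw [mul_add, mul_div_cancel₀ _ hr0.ne'] at h4
    linarith
  · have hk1' : (1 : ℝ) ≤ k := by exact_mod_cast hkpos
    have h1 : (n / r - 1) * (p * (1 + ρ) / 2 * l) ≤ (k - 1) * negLogLaplace p l := by
      refine le_trans (mul_le_mul_of_nonneg_right (show (n : ℝ) / r - 1 ≤ k - 1 by linarith) ?_)
        (mul_le_mul_of_nonneg_left hcl (by linarith))
      have : 0 < ρ := by positivity
      positivity
    have h2 : l * t n ≤ l * (ρ * p / r * n) := mul_le_mul_of_nonneg_left ht' hl.le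
    have h3 : (n / r - 1) * (p * (1 + ρ) / 2 * l) - l * (ρ * p / r * n) =
        a * n - p * (1 + ρ) / 2 * l := by
      simp only [a]
      field_simp
      ring
    have h4 : p * (1 + ρ) / 2 * l ≤ p * l := mul_le_mul_of_nonneg_right (by nlinarith) hl.le
    have h5 : 4 * Real.log n ≤ (k - 1) * negLogLaplace p l - l * t n := by
      have := mul_pos hp0 hl
      linarith
    have h6 := mul_le_mul_of_nonneg_left h5 (show (0 : ℝ) ≤ (k : ℝ) / 2 by positivity)
    have h7 := mul_le_mul_of_nonneg_right hk1' hlog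
    linarith

/-- For `t ∼ np / x`, any integer number `r > x` of colours suffices. -/
theorem eventually_bernoulliProb_not_le_of_linear (hp0 : 0 < p) (hp1 : p < 1) {x : ℝ} (hx : 0 < x)
    {r : ℕ} (hrx : x < r) {t : ℕ → ℝ}
    (ht : ∀ c, c < 1 → ∀ᶠ n : ℕ in atTop, c * (n * p / x) ≤ t n) :
    ∃ a, 0 < a ∧ ∀ᶠ n : ℕ in atTop, bernoulliProb p (fun ω : Sym2 (Fin n) → Bool =>
      ¬ (graphOf ω).improperChromaticNumber (t n) ≤ r) ≤ n * Real.exp (-(a * n)) := by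
  have hr0 : (0 : ℝ) < r := hx.trans hrx
  -- The midpoint threshold leaves room p(r-x)/(2x) above p: half goes to σ, half to rounding up the
  -- block size.
  set σ := min 1 (p * (r - x) / (4 * x))
  have hσ0 : 0 < σ := lt_min one_pos (div_pos (mul_pos hp0 (by linarith)) (by positivity))
  have hσ1 : σ ≤ 1 := min_le_left _ _
  have hσ2 : σ ≤ p * (r - x) / (4 * x) := min_le_right _ _
  refine ⟨σ ^ 2 / 4 / r, by positivity, ?_⟩
  have hc : (r + x) / (2 * r) < 1 := by rw [div_lt_one (by positivity)]; linarith
  have hgap : 0 < p * (r - x) / (4 * x * r) :=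
    div_pos (mul_pos hp0 (by linarith)) (by positivity)
  filter_upwards [ht _ hc, eventually_gt_atTop 0,
    (tendsto_natCast_atTop_atTop (R := ℝ)).eventually_ge_atTop (2 / (p * (r - x) / (4 * x * r)))]
    with n htn hn hngap
  have hn0 : (0 : ℝ) < n := Nat.cast_pos.2 hn
  rw [div_le_iff₀ hgap] at hngap
  set s := ⌈(n : ℝ) / r⌉₊
  have hs1 : (n : ℝ) / r ≤ s := Nat.le_ceil _
  have hspos : 0 < s := Nat.ceil_pos.2 (by positivity)
  have hs2 : (s : ℝ) ≤ n / r + 1 := (Nat.ceil_lt_add_one (by positivity)).le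
  have hnr : n ≤ r * s := by
    rw [div_le_iff₀ hr0] at hs1
    rw [mul_comm]
    exact_mod_cast hs1
  refine (bernoulliProb_lt_improperChromaticNumber_le hp0.le hp1.le hspos hnr hσ0.le hσ1
    (le_trans ?_ htn)).trans ?_
  · have h1 : (p + σ) * s ≤ (p + σ) * (n / r + 1) := mul_le_mul_of_nonneg_left hs2 (by positivity)
    have h2 : (p + σ) * (n / r) ≤ (p + p * (r - x) / (4 * x)) * (n / r) :=
      mul_le_mul_of_nonneg_right (by linarith) (by positivity)
    have h3 : (r + x) / (2 * r) * (n * p / x) =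
        (p + p * (r - x) / (4 * x)) * (n / r) + n * (p * (r - x) / (4 * x * r)) := by
      field_simp
      ring
    have h4 : p + σ ≤ 2 := by linarith
    rw [h3]
    linarith
  · refine mul_le_mul_of_nonneg_left (Real.exp_le_exp.2 (neg_le_neg ?_)) hn0.le
    have := mul_le_mul_of_nonneg_left hs1 (show 0 ≤ σ ^ 2 / 4 by positivity)
    refine le_trans (le_of_eq ?_) this
    field_simp

end Bounds

theorem theorem2 (p : unitInterval) (hp0 : 0 < (p : ℝ)) (hp1 : (p : ℝ) < 1) :
    ∃ κ : ℝ → ℝ,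
      ContinuousOn κ (Set.Ici 0) ∧
      StrictMonoOn κ (Set.Ici 0) ∧
      κ 0 = 2 / Real.log (1 / (1 - (p : ℝ))) ∧
      (κ ~[atTop] fun τ : ℝ => τ / (p : ℝ)) ∧
      ∀ t : ℕ → ℝ, (∀ n, 0 ≤ t n) →
        ((t =o[atTop] fun n : ℕ => (n : ℝ)) →
          EquivalentAAS p (fun n G => (G.improperChromaticNumber (t n) : ℝ))
            (fun n : ℕ => (n : ℝ) / (κ (t n / Real.log n) * Real.log n))) ∧
        (∀ x : ℝ, 0 < x → (∀ m : ℤ, x ≠ (m : ℝ)) →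
          (t ~[atTop] fun n : ℕ => (n : ℝ) * (p : ℝ) / x) →
          HoldsAAS p (fun n G => G.improperChromaticNumber (t n) = ⌈x⌉₊)) := by
  refine ⟨kappa p, kappa_continuousOn hp0 hp1, kappa_strictMonoOn hp0 hp1, ?_,
    kappa_isEquivalent hp0 hp1, fun t ht0 => ⟨fun hto ε₀ hε₀ => ?_, fun x hx hxm htx => ?_⟩⟩
  · rw [kappa_zero hp0 hp1, one_div, Real.log_inv]
  -- The estimates need ε ≤ 1, and a smaller ε is a stronger claim.
  · set ε := min ε₀ 1
    have hε : 0 < ε := lt_min hε₀ one_pos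
    have hε1 : ε ≤ 1 := min_le_right _ _
    have hεε₀ : ε ≤ ε₀ := min_le_left _ _
    obtain ⟨T, c, hT, hc, hlarge⟩ := exists_eventually_bernoulliProb_upper_le_of_ge hp0 hp1 hε hε1
    have hlim : Tendsto (fun n : ℕ => Real.exp (-(ε / 8 * Real.log n)) +
        (Real.exp (-(n : ℝ)) + Real.exp (-Real.log n))) atTop (𝓝 0) := by
      have h1 := Real.tendsto_exp_neg_atTop_nhds_zero.comp
        (tendsto_log_natCast.const_mul_atTop (show 0 < ε / 8 by positivity))
      have h2 := Real.tendsto_exp_neg_atTop_nhds_zero.comp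
        (tendsto_natCast_atTop_atTop (R := ℝ))
      have h3 := Real.tendsto_exp_neg_atTop_nhds_zero.comp tendsto_log_natCast
      simpa using h1.add (h2.add h3)
    refine holdsAAS_of_tendsto hlim ?_
    filter_upwards [eventually_bernoulliProb_lower_le hp0 hp1 hε hε1,
      eventually_bernoulliProb_upper_le_of_le hp0 hp1 hε hε1 hT.le, hlarge, hto.bound hc,
      tendsto_log_natCast.eventually_gt_atTop 0] with n hlow hup hup' htn hlog
    rw [Real.norm_eq_abs, abs_of_nonneg (ht0 n), Real.norm_eq_abs, Nat.abs_cast] at htn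
    have hf : 0 ≤ (n : ℝ) / (kappa p (t n / Real.log n) * Real.log n) :=
      div_nonneg (Nat.cast_nonneg n) (mul_nonneg
        (kappa_pos hp0 hp1 (div_nonneg (ht0 n) hlog.le)).le hlog.le)
    set f := (n : ℝ) / (kappa p (t n / Real.log n) * Real.log n)
    have hupper : bernoulliProb (p : ℝ) (fun ω : Sym2 (Fin n) → Bool =>
        ¬ ((graphOf ω).improperChromaticNumber (t n) : ℝ) ≤ (1 + ε) * f) ≤
          Real.exp (-(n : ℝ)) + Real.exp (-Real.log n) := by
      -- Both bounds are uniform in t, so the sequence may alternate between the two regimes.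
      rcases le_total (t n) (T * Real.log n) with h | h
      · exact (hup (t n) (ht0 n) h).trans (le_add_of_nonneg_right (Real.exp_pos _).le)
      · exact (hup' (t n) h htn).trans (le_add_of_nonneg_left (Real.exp_pos _).le)
    refine le_trans (bernoulliProb_mono hp0.le hp1.le fun ω hω => ?_)
      ((bernoulliProb_or_le hp0.le hp1.le _ _).trans (add_le_add (hlow (t n) (ht0 n)) hupper))
    by_contra hcon
    push Not at hcon
    refine hω ⟨le_trans ?_ hcon.1, hcon.2.trans ?_⟩
    · exact mul_le_mul_of_nonneg_right (by linarith) hf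
    · exact mul_le_mul_of_nonneg_right (by linarith) hf
  · have hbase : ∀ᶠ n : ℕ in atTop, 0 < (n : ℝ) * p / x := by
      filter_upwards [eventually_gt_atTop 0] with n hn
      have : (0 : ℝ) < n := Nat.cast_pos.2 hn
      positivity
    have hclose : ∀ δ, 0 < δ → ∀ᶠ n : ℕ in atTop, |t n - n * p / x| ≤ δ * (n * p / x) := by
      intro δ hδ
      filter_upwards [htx.isLittleO.bound hδ, hbase] with n hn hpos
      rwa [Pi.sub_apply, Real.norm_eq_abs, Real.norm_eq_abs, abs_of_pos hpos] at hn
    -- Only here is x required not to be an integer: it puts x strictly between ⌈x⌉ - 1 and ⌈x⌉,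
    -- which leaves room on both sides.
    have hceil : x < ⌈x⌉₊ := lt_of_le_of_ne (Nat.le_ceil x) fun h => hxm ⌈x⌉₊ (by exact_mod_cast h)
    have hpos : 0 < ⌈x⌉₊ := Nat.ceil_pos.2 hx
    have hfloor : ((⌈x⌉₊ - 1 : ℕ) : ℝ) < x := by
      rw [Nat.cast_sub hpos, Nat.cast_one]
      linarith [Nat.ceil_lt_add_one hx.le]
    have hlow := eventually_bernoulliProb_le_of_linear hp0 hp1 hx hfloor ht0 fun c hc => by
      filter_upwards [hclose (c - 1) (by linarith)] with n hn
      linarith [(abs_le.1 hn).2]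
    obtain ⟨a, ha, hup⟩ := eventually_bernoulliProb_not_le_of_linear hp0 hp1 hx hceil (t := t)
      fun c hc => by
        filter_upwards [hclose (1 - c) (by linarith)] with n hn
        linarith [(abs_le.1 hn).1]
    have hlim := (Real.tendsto_exp_neg_atTop_nhds_zero.comp tendsto_log_natCast).add
      (tendsto_natCast_mul_exp_neg ha)
    rw [add_zero] at hlim
    refine holdsAAS_of_tendsto hlim ?_
    filter_upwards [hlow, hup] with n h1 h2
    refine le_trans (bernoulliProb_mono hp0.le hp1.le fun ω hω => ?_)
      ((bernoulliProb_or_le hp0.le hp1.le _ _).trans (add_le_add h1 h2))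
    by_contra hcon
    push Not at hcon
    exact hω (by omega)
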